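/- For a group $G$ of isometries of $\mathbb R^3$ and a point $P\in\mathbb R^3$, the Dirichlet stereohedron of $G$ with base point $P$ is the closed Voronoi region $$\mathrm{Vor}_{GP}(P)=\{x\in\mathbb R^3 : |x-P|\le |x-Q| \text{ for all } Q\in GP\}$$ of $P$ in the Voronoi diagram of the orbit $GP$; its facets are its two-dimensional faces. A crystallographic group $G$ of $\mathbb R^3$ is said to be of type $H$, for a group $H$ of affine transformations of the coordinate space, if $G=\varphi H\varphi^{-1}$ for some affine coordinate system $\varphi$ of $\mathbb R^3$ (that is, $G$ belongs to the affine conjugacy class of $H$). In such coordinates $(x,y,z)$, let - $P\frac{2_1}{n}\frac{2}{c}\frac{2_1}{a}$ (International Tables no. 60) be the group generated by the translations of $\mathbb Z^3$ and $(x+\frac12,\,y+\frac12,\,-z+\frac12)$, $(-x,\,y,\,z+\frac12)$, $(x+\frac12,\,-y+\frac12,\,z)$; - $P\frac{2_1}{a}\frac{2_1}{b}\frac{2_1}{c}$ (International Tables no. 61) be the group generated by the translations of $\mathbb Z^3$ and $(x+\frac12,\,y,\,-z+\frac12)$, $(-x+\frac12,\,y+\frac12,\,z)$, $(x,\,-y+\frac12,\,z+\frac12)$.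 **Proposition.** Let $G$ be a crystallographic group of $\mathbb R^3$ of type $P\frac{2_1}{n}\frac{2}{c}\frac{2_1}{a}$ or $P\frac{2_1}{a}\frac{2_1}{b}\frac{2_1}{c}$, and let $P\in\mathbb R^3$. Then the Dirichlet stereohedron of $G$ with base point $P$ has at most $38$ facets. -/

import Mathlib

/-- Euclidean three-space. -/
abbrev E3 : Type := EuclideanSpace ℝ (Fin 3)

/-- The (closed) Voronoi region of the point `P` in the Voronoi diagram of the point set `S`. -/
def voronoiRegion (S : Set E3) (P : E3) : Set E3 :=
  {x | ∀ Q ∈ S, dist x P ≤ dist x Q}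

/-- The orbit of the point `P` under a group `G` of isometries of Euclidean three-space. -/
def isometryOrbit (G : Subgroup (E3 ≃ᵃⁱ[ℝ] E3)) (P : E3) : Set E3 :=
  {Q | ∃ g ∈ G, g P = Q}

/-- The Dirichlet stereohedron of `G` with base point `P`: the Voronoi region of `P` in the
Voronoi diagram of the orbit `G P`. -/
def dirichletStereohedron (G : Subgroup (E3 ≃ᵃⁱ[ℝ] E3)) (P : E3) : Set E3 :=
  voronoiRegion (isometryOrbit G P) P

/-- The facets of a three-dimensional convex polytope `K`: its faces of affine dimension two. -/
def facets (K : Set E3) : Set (Set E3) :=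
  {F | IsExposed ℝ K F ∧ Module.finrank ℝ (vectorSpan ℝ F) = 2}

/-- The affine map `x ↦ (ε₀ x₀ + t₀, ε₁ x₁ + t₁, ε₂ x₂ + t₂)` of the coordinate space `ℝ³`. -/
def coordOp (ε : Fin 3 → ℝˣ) (t : Fin 3 → ℝ) : (Fin 3 → ℝ) ≃ᵃ[ℝ] (Fin 3 → ℝ) where
  toFun x := fun i => (ε i : ℝ) * x i + t i
  invFun y := fun i => ((ε i)⁻¹ : ℝˣ) * (y i - t i)
  left_inv x := by funext i; simp
  right_inv y := by funext i; simp
  linear :=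
    { toFun := fun x i => (ε i : ℝ) * x i
      invFun := fun y i => ((ε i)⁻¹ : ℝˣ) * y i
      map_add' := fun x y => by funext i; simp [mul_add]
      map_smul' := fun c x => by funext i; simp [mul_left_comm]
      left_inv := fun x => by funext i; simp
      right_inv := fun y => by funext i; simp }
  map_vadd' p v := by
    funext i
    simp [mul_add, add_assoc]

/-- The three unit translations of the coordinate space, which generate the primitive
lattice `ℤ³`. -/
def unitTranslations : Set ((Fin 3 → ℝ) ≃ᵃ[ℝ] (Fin 3 → ℝ)) :=
  {coordOp ![1, 1, 1] ![1, 0, 0], coordOp ![1, 1, 1] ![0, 1, 0], coordOp ![1, 1, 1] ![0, 0, 1]}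

/-- The space group `P 2₁/n 2/c 2₁/a` in lattice coordinates `(x, y, z)`; the three parts of the
symbol refer to the axes `z`, `x`, `y`, in this order. (It is number 60 of the International
Tables, `Pbcn`, there in the setting `Pcan`.) Besides the lattice translations, the
generators are the glide reflections

* `n`, orthogonal to `z` : `(x + 1/2, y + 1/2, -z + 1/2)`,
* `c`, orthogonal to `x` : `(-x, y, z + 1/2)`,
* `a`, orthogonal to `y` : `(x + 1/2, -y + 1/2, z)`.

Modulo the lattice, their products are the identity, the inversion `(-x, -y, -z)`, the screw
rotations `(-x + 1/2, -y + 1/2, z + 1/2)` and `(-x + 1/2, y + 1/2, -z)` in the directions `z`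
and `y`, and the rotation `(x, -y, -z + 1/2)` in the direction `x`. -/
def spaceGroupP21n2c21a : Subgroup ((Fin 3 → ℝ) ≃ᵃ[ℝ] (Fin 3 → ℝ)) :=
  Subgroup.closure (unitTranslations ∪
    {coordOp ![1, 1, -1] ![1 / 2, 1 / 2, 1 / 2],
     coordOp ![-1, 1, 1] ![0, 0, 1 / 2],
     coordOp ![1, -1, 1] ![1 / 2, 1 / 2, 0]})

/-- The space group `P 2₁/a 2₁/b 2₁/c` in lattice coordinates `(x, y, z)`; the three parts of the
symbol refer to the axes `z`, `x`, `y`, in this order. (It is number 61 of the International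
Tables, `Pbca`.) Besides the lattice translations, the generators are the glide
reflections

* `a`, orthogonal to `z` : `(x + 1/2, y, -z + 1/2)`,
* `b`, orthogonal to `x` : `(-x + 1/2, y + 1/2, z)`,
* `c`, orthogonal to `y` : `(x, -y + 1/2, z + 1/2)`.

Modulo the lattice, their products are the identity, the inversion `(-x, -y, -z)`, and the
screw rotations `(-x + 1/2, -y, z + 1/2)`, `(x + 1/2, -y + 1/2, -z)` and
`(-x, y + 1/2, -z + 1/2)` in the directions `z`, `x` and `y`. -/
def spaceGroupP21a21b21c : Subgroup ((Fin 3 → ℝ) ≃ᵃ[ℝ] (Fin 3 → ℝ)) :=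
  Subgroup.closure (unitTranslations ∪
    {coordOp ![1, 1, -1] ![1 / 2, 0, 1 / 2],
     coordOp ![-1, 1, 1] ![1 / 2, 1 / 2, 0],
     coordOp ![1, -1, 1] ![0, 1 / 2, 1 / 2]})

/-- The group `G` of isometries of Euclidean space belongs to the affine conjugacy class of the
group `H`, which is given in affine coordinates: for some affine coordinate system `φ` of
Euclidean space, `G = φ H φ⁻¹`. -/
def IsOfType (G : Subgroup (E3 ≃ᵃⁱ[ℝ] E3))
    (H : Subgroup ((Fin 3 → ℝ) ≃ᵃ[ℝ] (Fin 3 → ℝ))) : Prop :=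
  ∃ φ : (Fin 3 → ℝ) ≃ᵃ[ℝ] E3,
    {f : E3 ≃ᵃ[ℝ] E3 | ∃ g ∈ G, g.toAffineEquiv = f} =
      {f : E3 ≃ᵃ[ℝ] E3 | ∃ h ∈ H, (φ.symm.trans h).trans φ = f}

open Filter Topology

/-! Every facet lies in the bisector of `P` and another orbit point `Q` and is determined by `Q`
(`exists_eq_contactSet`), so it suffices to bound the relevant differences `Q - P`. The sieve is
`finrank_contactSet_ne_two`: a difference that splits into two nonzero differences of the orbit with
nonnegative scalar product yields no facet.

The glides force the coordinate axes to be orthogonal (`exists_diagInner`), so scalar products of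
differences are diagonal with positive weights `A`, `B`, `C`. The differences form eight cosets of
the integer lattice, one for each element of the point group. Splitting off a unit vector leaves
only the six unit vectors and vectors of the open box `(-1, 1)³` (`irreducibles_box`). In the box, a
coordinate has at most one value in the class of `0` and at most two in any other class.

Splitting a vector into two vectors of other cosets halves or quarters some of the remaining counts.
For Pbca the total is `6 + 3·4 + 8 + 3·4 = 38`, with three glides, the inversion and three screws.
For Pbcn the same sieve gives `6 + 8 + 4 + 4 + 2 + 4 + 4 + 4 = 36`. -/

/-! ### Facets of the Voronoi region of a locally finite set -/

/-- A set of points of Euclidean space with finitely many points in every ball. -/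
def LocFinite (S : Set E3) : Prop := ∀ x r, (S ∩ Metric.closedBall x r).Finite

/-- Moving `x₀` by less than `1` changes each distance by less than `1`, so points farther than
`dist x₀ P + 2` stay farther than `P`. The finitely many others are handled by continuity. -/
theorem LocFinite.eventually_dist_lt {S : Set E3} (hS : LocFinite S) (P x₀ : E3) :
    ∀ᶠ x in 𝓝 x₀, ∀ Q ∈ S, dist x₀ P < dist x₀ Q → dist x P < dist x Q := by
  have hfin := hS x₀ (dist x₀ P + 2)
  have h1 : ∀ᶠ x in 𝓝 x₀, ∀ Q ∈ S ∩ Metric.closedBall x₀ (dist x₀ P + 2),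
      dist x₀ P < dist x₀ Q → dist x P < dist x Q := by
    rw [hfin.eventually_all]
    intro Q _
    by_cases h : dist x₀ P < dist x₀ Q
    · have : ∀ᶠ x in 𝓝 x₀, dist x P < dist x Q :=
        (by fun_prop : ContinuousAt (fun x => dist x P) x₀).eventually_lt
          (by fun_prop : ContinuousAt (fun x => dist x Q) x₀) h
      filter_upwards [this] with x hx _ using hx
    · exact Eventually.of_forall fun x hx => absurd hx h
  filter_upwards [h1, Metric.ball_mem_nhds x₀ one_pos] with x hx hb Q hQ hlt
  by_cases hc : Q ∈ Metric.closedBall x₀ (dist x₀ P + 2)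
  · exact hx Q ⟨hQ, hc⟩ hlt
  · rw [Metric.mem_closedBall, dist_comm] at hc
    rw [Metric.mem_ball] at hb
    have := dist_triangle x x₀ P
    have := dist_triangle_left x₀ Q x
    linarith

theorem dist_sq_eq_add_inner (P Q x : E3) :
    dist x Q ^ 2 = dist x P ^ 2 - 2 * inner ℝ (Q - P) (x - P) + inner ℝ (Q - P) (Q - P) := by
  rw [dist_eq_norm, dist_eq_norm, show x - Q = (x - P) - (Q - P) by abel, norm_sub_sq_real,
    real_inner_self_eq_norm_sq, real_inner_comm]

theorem dist_le_dist_iff_inner (P Q x : E3) :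
    dist x P ≤ dist x Q ↔ 2 * inner ℝ (Q - P) (x - P) ≤ inner ℝ (Q - P) (Q - P) := by
  rw [← sq_le_sq₀ dist_nonneg dist_nonneg, dist_sq_eq_add_inner P Q x]
  constructor <;> intro <;> linarith

theorem dist_eq_dist_iff_inner (P Q x : E3) :
    dist x P = dist x Q ↔ 2 * inner ℝ (Q - P) (x - P) = inner ℝ (Q - P) (Q - P) := by
  rw [← sq_eq_sq₀ dist_nonneg dist_nonneg, dist_sq_eq_add_inner P Q x]
  constructor <;> intro <;> linarith

theorem convex_voronoiRegion (S : Set E3) (P : E3) : Convex ℝ (voronoiRegion S P) := by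
  have : voronoiRegion S P =
      ⋂ Q ∈ S, {x | inner ℝ (Q - P) x ≤ inner ℝ (Q - P) (Q - P) / 2 + inner ℝ (Q - P) P} := by
    ext x
    simp only [voronoiRegion, Set.mem_ofPred_eq, Set.mem_iInter]
    refine forall₂_congr fun Q _ => ?_
    rw [dist_le_dist_iff_inner, inner_sub_right]
    constructor <;> intro <;> linarith
  rw [this]
  exact convex_iInter₂ fun Q _ => convex_halfSpace_le
    (IsLinearMap.mk (fun x y => inner_add_right _ x y) fun c x => by simp [inner_smul_right]) _

/-- The points of `S` other than `P` which are as close to `x` as `P`. -/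
def activePoints (S : Set E3) (P x : E3) : Set E3 :=
  {Q | Q ∈ S ∧ Q ≠ P ∧ dist x P = dist x Q}

theorem LocFinite.finite_activePoints {S : Set E3} (hS : LocFinite S) (P x : E3) :
    (activePoints S P x).Finite :=
  (hS x (dist x P)).subset fun Q hQ => ⟨hQ.1, by
    rw [Metric.mem_closedBall, dist_comm, hQ.2.2]⟩

/-- In a convex part `F` of the Voronoi region, a point with the smallest number of active
points has only those active points which are shared by all of `F`. -/
theorem exists_common_activePoints {S : Set E3} (hS : LocFinite S) {P : E3} {F : Set E3}
    (hF : F.Nonempty) (hconv : Convex ℝ F) (hFK : F ⊆ voronoiRegion S P) :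
    ∃ x₀ ∈ F, ∀ Q ∈ activePoints S P x₀, ∀ y ∈ F, dist y P = dist y Q := by
  obtain ⟨x₀, hx₀, hmin⟩ : ∃ x₀ ∈ F, ∀ y ∈ F,
      (activePoints S P x₀).ncard ≤ (activePoints S P y).ncard := by
    obtain ⟨x, hx, h⟩ := (InvImage.wf (fun x => (activePoints S P x).ncard)
      (Nat.lt_wfRel.wf)).has_min F hF
    exact ⟨x, hx, fun y hy => not_lt.1 (h y hy)⟩
  refine ⟨x₀, hx₀, fun Q hQ y hy => ?_⟩
  by_contra hne
  -- A small step from `x₀` towards `y` activates no new point and loses `Q`, contradicting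
  -- minimality.
  have hlt : dist y P < dist y Q := lt_of_le_of_ne (hFK hy Q hQ.1) hne
  have hcont : ContinuousAt (fun t : ℝ => AffineMap.lineMap x₀ y t) 0 :=
    AffineMap.lineMap_continuous.continuousAt
  have hev := hcont.tendsto.eventually (by
    simpa using hS.eventually_dist_lt P x₀)
  have hev2 : ∀ᶠ t : ℝ in 𝓝[>] 0, t < 1 := nhdsWithin_le_nhds (Iio_mem_nhds one_pos)
  obtain ⟨t, ht, ht1, ht0⟩ :=
    ((hev.filter_mono (nhdsWithin_le_nhds (s := Set.Ioi 0))).and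
      (hev2.and self_mem_nhdsWithin)).exists
  set x := AffineMap.lineMap x₀ y t with hxdef
  have hxF : x ∈ F := hconv.lineMap_mem hx₀ hy ⟨le_of_lt ht0, ht1.le⟩
  have hsub : activePoints S P x ⊆ activePoints S P x₀ := fun R hR => by
    refine ⟨hR.1, hR.2.1, ?_⟩
    by_contra h
    exact (ht R hR.1 (lt_of_le_of_ne (hFK hx₀ R hR.1) h)).ne hR.2.2
  -- The defect of equidistance from `P` and `Q` is affine on the segment; it vanishes at `x₀` but
  -- not at `y`, hence not at `x`.
  have hQx : Q ∉ activePoints S P x := fun h => by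
    have e1 := (dist_eq_dist_iff_inner P Q x).1 h.2.2
    have e0 := (dist_eq_dist_iff_inner P Q x₀).1 hQ.2.2
    have e2 := mt (dist_eq_dist_iff_inner P Q y).2 hne
    have : x - P = (1 - t) • (x₀ - P) + t • (y - P) := by
      rw [hxdef, AffineMap.lineMap_apply]
      simp only [vsub_eq_sub, vadd_eq_add]
      module
    rw [this, inner_add_right, inner_smul_right, inner_smul_right] at e1
    apply e2
    have ht0' : t ≠ 0 := ne_of_gt ht0
    apply mul_left_cancel₀ ht0'
    linear_combination e1 - (1 - t) * e0
  exact absurd (hmin x hxF) (not_le.2 (Set.ncard_lt_ncard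
    (Set.ssubset_iff_of_subset hsub |>.2 ⟨Q, hQ, hQx⟩) (hS.finite_activePoints P x₀)))

theorem finrank_vectorSpan_of_mem_interior {F : Set E3} {x : E3} (h : F ∈ 𝓝 x) :
    Module.finrank ℝ (vectorSpan ℝ F) = 3 := by
  have h2 : vectorSpan ℝ F = ⊤ := by
    rw [← direction_affineSpan]
    have : affineSpan ℝ F = ⊤ := by
      refine top_le_iff.1 ?_
      rw [← (isOpen_interior (s := F)).affineSpan_eq_top ⟨x, mem_interior_iff_mem_nhds.2 h⟩]
      exact affineSpan_mono ℝ interior_subset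
    rw [this, AffineSubspace.direction_top]
  rw [h2, finrank_top]
  simp

/-- The part of the Voronoi region which is as close to `Q` as to `P`. -/
def contactSet (S : Set E3) (P Q : E3) : Set E3 :=
  {x | x ∈ voronoiRegion S P ∧ dist x P = dist x Q}

theorem vectorSpan_le_orthogonal {P Q : E3} {F : Set E3} (h : ∀ x ∈ F, dist x P = dist x Q) :
    vectorSpan ℝ F ≤ (ℝ ∙ (Q - P))ᗮ := by
  rw [vectorSpan, Submodule.span_le]
  rintro _ ⟨x, hx, y, hy, rfl⟩
  have e1 := (dist_eq_dist_iff_inner P Q x).1 (h x hx)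
  have e2 := (dist_eq_dist_iff_inner P Q y).1 (h y hy)
  simp only [SetLike.mem_coe, Submodule.mem_orthogonal_singleton_iff_inner_right, vsub_eq_sub]
  rw [show x - y = (x - P) - (y - P) by abel, inner_sub_right]
  linarith

theorem finrank_orthogonal_singleton {v : E3} (hv : v ≠ 0) :
    Module.finrank ℝ ((ℝ ∙ v)ᗮ : Submodule ℝ E3) = 2 := by
  have : Fact (Module.finrank ℝ E3 = 2 + 1) := ⟨by simp⟩
  exact Submodule.finrank_orthogonal_span_singleton hv

/-- At a point `x₀` of the facet with fewest active points, some `Q` must be active, since otherwise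
the exposing functional would have an interior maximum and vanish. By minimality the whole facet
lies in the bisector of `P` and `Q`. Having dimension two, it spans the directions of that plane, so
the functional is constant on the bisector and the facet is the full contact set. -/
theorem exists_eq_contactSet {S : Set E3} (hS : LocFinite S) {P : E3}
    {F : Set E3} (hF : F ∈ facets (voronoiRegion S P)) :
    ∃ Q ∈ S, Q ≠ P ∧ F = contactSet S P Q := by
  obtain ⟨hexp, hdim⟩ := hF
  have hne : F.Nonempty := by
    rw [Set.nonempty_iff_ne_empty]
    rintro rfl
    rw [vectorSpan_empty, finrank_bot] at hdim
    omega
  obtain ⟨x₀, hx₀, hcommon⟩ := exists_common_activePoints hS hne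
    (hexp.convex (convex_voronoiRegion S P)) hexp.subset
  obtain ⟨l, hl⟩ := hexp hne
  have hx₀K : x₀ ∈ voronoiRegion S P := hexp.subset hx₀
  have hmax : ∀ y ∈ voronoiRegion S P, l y ≤ l x₀ := by
    have := hx₀; rw [hl] at this; exact this.2
  have hnhds : ∀ x₁ ∈ voronoiRegion S P, activePoints S P x₁ = ∅ → voronoiRegion S P ∈ 𝓝 x₁ := by
    intro x₁ hx₁ h
    filter_upwards [hS.eventually_dist_lt P x₁] with x hx Q hQ
    by_cases hQP : Q = P
    · rw [hQP]
    · refine (hx Q hQ (lt_of_le_of_ne (hx₁ Q hQ) fun he => ?_)).le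
      have : Q ∈ activePoints S P x₁ := ⟨hQ, hQP, he⟩
      rw [h] at this
      exact this
  -- A zero functional exposes the whole region, which has `P` in its interior and so has dimension
  -- three.
  have hl0 : l ≠ 0 := by
    rintro rfl
    have hFK : F = voronoiRegion S P := by rw [hl]; simp
    have hP : activePoints S P P = ∅ := by
      ext Q
      simp only [activePoints, dist_self, Set.mem_ofPred_eq, Set.mem_empty_iff_false, iff_false]
      rintro ⟨_, h1, h2⟩
      exact h1 (dist_eq_zero.1 h2.symm).symm
    have := finrank_vectorSpan_of_mem_interior
      (hnhds P (fun Q _ => by rw [dist_self]; exact dist_nonneg) hP)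
    rw [hFK] at hdim
    omega
  obtain ⟨Q, hQ⟩ : (activePoints S P x₀).Nonempty := by
    rw [Set.nonempty_iff_ne_empty]
    intro h
    apply hl0
    have hloc : IsLocalMax l x₀ := by
      filter_upwards [hnhds x₀ hx₀K h] with y hy using hmax y hy
    rw [← l.hasFDerivAt.fderiv (x := x₀)]
    exact hloc.fderiv_eq_zero
  refine ⟨Q, hQ.1, hQ.2.1, ?_⟩
  have hspanQ : vectorSpan ℝ F = (ℝ ∙ (Q - P))ᗮ := by
    refine Submodule.eq_of_le_of_finrank_eq (vectorSpan_le_orthogonal (hcommon Q hQ)) ?_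
    rw [hdim, finrank_orthogonal_singleton (sub_ne_zero.2 hQ.2.1)]
  have hspanl : vectorSpan ℝ F ≤ LinearMap.ker l.toLinearMap := by
    rw [vectorSpan, Submodule.span_le]
    rintro _ ⟨x, hx, y, hy, rfl⟩
    rw [hl] at hx hy
    have := hx.2 y hy.1
    have := hy.2 x hx.1
    simp only [SetLike.mem_coe, LinearMap.mem_ker, vsub_eq_sub, map_sub]
    show l x - l y = 0
    linarith
  ext x
  refine ⟨fun hx => ⟨hexp.subset hx, hcommon Q hQ x hx⟩, fun hx => ?_⟩
  have hmem : x - x₀ ∈ (ℝ ∙ (Q - P))ᗮ := by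
    rw [Submodule.mem_orthogonal_singleton_iff_inner_right,
      show x - x₀ = (x - P) - (x₀ - P) by abel, inner_sub_right]
    have e1 := (dist_eq_dist_iff_inner P Q x).1 hx.2
    have e2 := (dist_eq_dist_iff_inner P Q x₀).1 hQ.2.2
    linarith
  rw [← hspanQ] at hmem
  have : l (x - x₀) = 0 := hspanl hmem
  rw [map_sub] at this
  rw [hl]
  exact ⟨hx.1, fun y hy => by have := hmax y hy; linarith⟩

/-- If `Q - P` is the sum of two nonzero vectors `W - P` and `U - P` at an angle of at most `π / 2`,
with `W` and `U` in `S`, then `Q` contributes no facet to the Voronoi region of `P`. -/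
theorem finrank_contactSet_ne_two {S : Set E3} {P Q W U : E3} (hW : W ∈ S) (hU : U ∈ S)
    (hWP : W - P ≠ 0) (hUP : U - P ≠ 0) (hsum : (W - P) + (U - P) = Q - P)
    (hin : 0 ≤ inner ℝ (W - P) (U - P)) :
    Module.finrank ℝ (vectorSpan ℝ (contactSet S P Q)) ≠ 2 := by
  intro hdim
  -- Adding the inequalities for `W` and `U` and comparing with the equation for `Q` forces all
  -- three to be tight.
  have key : ∀ x ∈ contactSet S P Q, inner ℝ (W - P) (U - P) = 0 ∧
      dist x P = dist x W ∧ dist x P = dist x U := by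
    intro x hx
    have e1 := (dist_le_dist_iff_inner P W x).1 (hx.1 W hW)
    have e2 := (dist_le_dist_iff_inner P U x).1 (hx.1 U hU)
    have e3 := (dist_eq_dist_iff_inner P Q x).1 hx.2
    rw [dist_eq_dist_iff_inner, dist_eq_dist_iff_inner]
    rw [← hsum, inner_add_left, real_inner_add_add_self] at e3
    refine ⟨?_, ?_, ?_⟩ <;> linarith
  obtain ⟨x, hx⟩ : (contactSet S P Q).Nonempty := by
    rw [Set.nonempty_iff_ne_empty]
    intro h
    rw [h, vectorSpan_empty, finrank_bot] at hdim
    omega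
  have h0 := (key x hx).1
  have hW2 := vectorSpan_le_orthogonal fun x hx => (key x hx).2.1
  have hU2 := vectorSpan_le_orthogonal fun x hx => (key x hx).2.2
  -- A two-dimensional contact set would fill the plane orthogonal to `U - P`. That plane contains
  -- `W - P`, which would then be orthogonal to itself.
  have heq : vectorSpan ℝ (contactSet S P Q) = (ℝ ∙ (U - P))ᗮ :=
    Submodule.eq_of_le_of_finrank_eq hU2 (by rw [hdim, finrank_orthogonal_singleton hUP])
  rw [heq] at hW2
  have hmem : W - P ∈ (ℝ ∙ (U - P))ᗮ := by
    rw [Submodule.mem_orthogonal_singleton_iff_inner_right, real_inner_comm]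
    exact h0
  have := hW2 hmem
  rw [Submodule.mem_orthogonal_singleton_iff_inner_right, inner_self_eq_zero] at this
  exact hWP this

/-! ### Counting representatives of residue classes modulo the integers -/

/-- The real numbers congruent to `α` modulo the integers. -/
def intClass (α : ℝ) : Set ℝ := {t | ∃ k : ℤ, t = α + k}

theorem add_intCast_mem_intClass {α t : ℝ} (h : t ∈ intClass α) (k : ℤ) :
    t + k ∈ intClass α := by
  obtain ⟨m, rfl⟩ := h
  exact ⟨m + k, by push_cast; ring⟩

theorem encard_pair_le_two {α : Type*} (a b : α) : ({a, b} : Set α).encard ≤ 2 := by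
  refine (Set.encard_insert_le _ _).trans ?_
  rw [Set.encard_singleton, one_add_one_eq_two]

theorem fract_cases {α t : ℝ} (h : t ∈ intClass α) (h1 : |t| < 1) :
    t = Int.fract α ∨ t = Int.fract α - 1 := by
  obtain ⟨k, rfl⟩ := h
  rw [abs_lt] at h1
  have h2 := Int.self_sub_floor α
  have h3 := Int.fract_nonneg α
  have h4 := Int.fract_lt_one α
  have h5 : -1 ≤ ⌊α⌋ + k := by
    have : (-2 : ℝ) < ((⌊α⌋ + k : ℤ) : ℝ) := by push_cast; linarith
    have : (-2 : ℤ) < ⌊α⌋ + k := by exact_mod_cast this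
    omega
  have h6 : ⌊α⌋ + k ≤ 0 := by
    have : ((⌊α⌋ + k : ℤ) : ℝ) < 1 := by push_cast; linarith
    have : ⌊α⌋ + k < (1 : ℤ) := by exact_mod_cast this
    omega
  obtain h | h : ⌊α⌋ + k = 0 ∨ ⌊α⌋ + k = -1 := by omega
  · left
    have : (⌊α⌋ : ℝ) + k = 0 := by exact_mod_cast h
    linarith
  · right
    have : (⌊α⌋ : ℝ) + k = -1 := by exact_mod_cast h
    linarith

theorem half_cases {t : ℝ} (h : t ∈ intClass (1 / 2)) (h1 : |t| < 1) : t = 1 / 2 ∨ t = -1 / 2 := by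
  have hf : Int.fract (1 / 2 : ℝ) = 1 / 2 := Int.fract_eq_self.2 (by norm_num)
  rcases fract_cases h h1 with h | h
  · left; rw [h, hf]
  · right; rw [h, hf]; norm_num

theorem intClass_eq_zero {t : ℝ} (h : t ∈ intClass 0) (h1 : |t| < 1) : t = 0 := by
  obtain ⟨k, rfl⟩ := h
  rw [zero_add] at h1 ⊢
  have : |k| < 1 := by exact_mod_cast h1
  exact_mod_cast Int.abs_lt_one_iff.1 this

theorem encard_intClass_zero : (intClass 0 ∩ {t | |t| < 1}).encard ≤ 1 := by
  rw [Set.encard_le_one_iff]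
  rintro a b ⟨ha, ha'⟩ ⟨hb, hb'⟩
  rw [intClass_eq_zero ha ha', intClass_eq_zero hb hb']

theorem encard_intClass (α : ℝ) : (intClass α ∩ {t | |t| < 1}).encard ≤ 2 := by
  refine (Set.encard_le_encard (t := {Int.fract α, Int.fract α - 1}) ?_).trans
    (encard_pair_le_two _ _)
  rintro t ⟨ht, ht'⟩
  exact fract_cases ht ht'

theorem encard_intClass_near (α : ℝ) : (intClass α ∩ {t | |t| < 1 / 2}).encard ≤ 1 := by
  rw [Set.encard_le_one_iff]
  rintro _ _ ⟨⟨k, rfl⟩, ha⟩ ⟨⟨m, rfl⟩, hb⟩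
  simp only [Set.mem_ofPred_eq, abs_lt] at ha hb
  have h1 : ((k - m : ℤ) : ℝ) < 1 := by push_cast; linarith
  have h2 : (-1 : ℝ) < ((k - m : ℤ) : ℝ) := by push_cast; linarith
  have h1' : k - m < 1 := by exact_mod_cast h1
  have h2' : -1 < k - m := by exact_mod_cast h2
  rw [show k = m by omega]

/-- Replacing both fractional parts `f`, `g` by `f - 1`, `g - 1` changes the sign of the form, and
so does exchanging `(f, g - 1)` with `(f - 1, g)`. Each of these two pairs therefore contributes at
most one solution of the strict inequality. -/
theorem encard_intClass_pair (α β A B : ℝ) :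
    {p : ℝ × ℝ | p.1 ∈ intClass α ∧ p.2 ∈ intClass β ∧ |p.1| < 1 ∧ |p.2| < 1 ∧
      A * (|p.1| - 1 / 2) + B * (|p.2| - 1 / 2) < 0}.encard ≤ 2 := by
  have habs : ∀ γ : ℝ, |Int.fract γ| = Int.fract γ ∧ |Int.fract γ - 1| = 1 - Int.fract γ :=
    fun γ => ⟨abs_of_nonneg (Int.fract_nonneg γ), by
      rw [abs_of_nonpos (by linarith [Int.fract_lt_one γ])]; ring⟩
  set f := Int.fract α with hf
  set g := Int.fract β with hg
  obtain ⟨a1, a2⟩ := habs α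
  obtain ⟨b1, b2⟩ := habs β
  rw [← hf] at a1 a2
  rw [← hg] at b1 b2
  refine (Set.encard_le_encard (t :=
    {if A * (f - 1 / 2) + B * (g - 1 / 2) < 0 then (f, g) else (f - 1, g - 1),
     if A * (f - 1 / 2) - B * (g - 1 / 2) < 0 then (f, g - 1) else (f - 1, g)}) ?_).trans
    (encard_pair_le_two _ _)
  rintro ⟨s, t⟩ ⟨hs, ht, hs1, ht1, h⟩
  simp only at hs ht hs1 ht1 h
  rw [Set.mem_insert_iff, Set.mem_singleton_iff]
  rcases fract_cases hs hs1 with rfl | rfl <;> rcases fract_cases ht ht1 with rfl | rfl <;>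
    simp only [← hf, ← hg, a1, a2, b1, b2] at h ⊢
  · left; rw [if_pos h]
  · right; rw [if_pos (by linarith)]
  · right; rw [if_neg (by linarith)]
  · left; rw [if_neg (by linarith)]

theorem encard_prod_le {α β : Type*} {s : Set α} {t : Set β} {m n : ℕ∞} (hs : s.encard ≤ m)
    (ht : t.encard ≤ n) : (s ×ˢ t).encard ≤ m * n := by
  rw [Set.encard_prod]
  exact mul_le_mul' hs ht

theorem encard_union_le_add {α : Type*} {s t : Set α} {m n : ℕ∞} (hs : s.encard ≤ m)
    (ht : t.encard ≤ n) : (s ∪ t).encard ≤ m + n :=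
  (Set.encard_union_le s t).trans (add_le_add hs ht)

/-! ### Irreducible differences for a diagonal metric -/

/-- The scalar product with matrix `diag(A, B, C)`. -/
def diagInner (A B C : ℝ) (v w : ℝ × ℝ × ℝ) : ℝ :=
  A * v.1 * w.1 + B * v.2.1 * w.2.1 + C * v.2.2 * w.2.2

/-- The nonzero elements of `D` which are not the sum of two nonzero elements of `D` with
nonnegative scalar product. -/
def irreducibles (A B C : ℝ) (D : Set (ℝ × ℝ × ℝ)) : Set (ℝ × ℝ × ℝ) :=
  {v | v ∈ D ∧ v ≠ 0 ∧ ∀ w ∈ D, ∀ u ∈ D, w ≠ 0 → u ≠ 0 → w + u = v → diagInner A B C w u < 0}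

/-- The six vectors of the standard cross. -/
def crossVectors : Set (ℝ × ℝ × ℝ) :=
  {(1, 0, 0), (-1, 0, 0), (0, 1, 0), (0, -1, 0), (0, 0, 1), (0, 0, -1)}

theorem encard_crossVectors : crossVectors.encard ≤ 6 := by
  unfold crossVectors
  refine (Set.encard_insert_le _ _).trans ?_
  refine (add_le_add_left ((Set.encard_insert_le _ _).trans (add_le_add_left
    ((Set.encard_insert_le _ _).trans (add_le_add_left ((Set.encard_insert_le _ _).trans
      (add_le_add_left (encard_pair_le_two _ _) _)) _)) _)) _).trans ?_
  norm_num

/-- `D` contains the integer vectors and is invariant under adding them. -/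
def LatticeInvariant (D : Set (ℝ × ℝ × ℝ)) : Prop :=
  0 ∈ D ∧ ∀ v ∈ D, ∀ i j k : ℤ, v + ((i : ℝ), (j : ℝ), (k : ℝ)) ∈ D

theorem exists_sign_mul_eq_abs (t : ℝ) : ∃ s : ℤ, (s = 1 ∨ s = -1) ∧ (s : ℝ) * t = |t| := by
  rcases le_total 0 t with h | h
  · exact ⟨1, Or.inl rfl, by rw [abs_of_nonneg h]; simp⟩
  · exact ⟨-1, Or.inr rfl, by rw [abs_of_nonpos h]; simp⟩

/-- If a coordinate satisfies `|t| ≥ 1`, split off the unit vector of its sign. The scalar product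
with the rest is a positive weight times `|t| - 1`, so irreducibility forces the rest to vanish. -/
theorem irreducibles_box {A B C : ℝ} (hA : 0 < A) (hB : 0 < B) (hC : 0 < C)
    {D : Set (ℝ × ℝ × ℝ)} (hD : LatticeInvariant D) {v : ℝ × ℝ × ℝ}
    (hv : v ∈ irreducibles A B C D) :
    v ∈ crossVectors ∨ (|v.1| < 1 ∧ |v.2.1| < 1 ∧ |v.2.2| < 1) := by
  obtain ⟨x, y, z⟩ := v
  obtain ⟨hvD, hv0, hirr⟩ := hv
  have key : ∀ i j k : ℤ, ((i : ℝ), (j : ℝ), (k : ℝ)) ≠ (0 : ℝ × ℝ × ℝ) →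
      0 ≤ diagInner A B C ((i : ℝ), (j : ℝ), (k : ℝ)) (x - i, y - j, z - k) →
      (x, y, z) = ((i : ℝ), (j : ℝ), (k : ℝ)) := by
    intro i j k hne hin
    by_contra hcon
    refine absurd (hirr (i, j, k) ?_ (x - i, y - j, z - k) ?_ hne ?_ ?_) (not_lt.2 hin)
    · simpa using hD.2 0 hD.1 i j k
    · simpa [sub_eq_add_neg] using hD.2 _ hvD (-i) (-j) (-k)
    · intro h
      apply hcon
      simp only [Prod.mk_eq_zero, sub_eq_zero] at h
      rw [h.1, h.2.1, h.2.2]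
    · simp
  by_contra! hcon
  obtain ⟨h1, h2⟩ := hcon
  have hmul : ∀ (s : ℤ) (A t : ℝ), 0 < A → (s = 1 ∨ s = -1) → (s : ℝ) * t = |t| → 1 ≤ |t| →
      0 ≤ A * s * (t - s) := by
    intro s A t hA hs hst ht
    have : (s : ℝ) * s = 1 := by rcases hs with rfl | rfl <;> norm_num
    rw [show A * s * (t - s) = A * (s * t - s * s) by ring, hst, this]
    exact mul_nonneg hA.le (by linarith)
  by_cases hx : |x| < 1
  · by_cases hy : |y| < 1
    · obtain ⟨s, hs, hst⟩ := exists_sign_mul_eq_abs z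
      have := key 0 0 s (by rcases hs with rfl | rfl <;> simp)
        (by simpa [diagInner] using hmul s C z hC hs hst (h2 hx hy))
      apply h1
      rw [this]
      rcases hs with rfl | rfl <;> simp [crossVectors]
    · obtain ⟨s, hs, hst⟩ := exists_sign_mul_eq_abs y
      have := key 0 s 0 (by rcases hs with rfl | rfl <;> simp)
        (by simpa [diagInner] using hmul s B y hB hs hst (not_lt.1 hy))
      apply h1
      rw [this]
      rcases hs with rfl | rfl <;> simp [crossVectors]
  · obtain ⟨s, hs, hst⟩ := exists_sign_mul_eq_abs x
    have := key s 0 0 (by rcases hs with rfl | rfl <;> simp)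
      (by simpa [diagInner] using hmul s A x hA hs hst (not_lt.1 hx))
    apply h1
    rw [this]
    rcases hs with rfl | rfl <;> simp [crossVectors]

theorem half_mem_intClass {s : ℤ} (hs : s = 1 ∨ s = -1) : (s : ℝ) / 2 ∈ intClass (1 / 2) := by
  rcases hs with rfl | rfl
  · exact ⟨0, by norm_num⟩
  · exact ⟨-1, by norm_num⟩

theorem sub_mem_intClass {α β γ s t : ℝ} (ht : t ∈ intClass α) (hs : s ∈ intClass γ)
    (h : ∃ k : ℤ, α = β + γ + k) : t - s ∈ intClass β := by
  obtain ⟨i, rfl⟩ := ht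
  obtain ⟨j, rfl⟩ := hs
  obtain ⟨k, rfl⟩ := h
  exact ⟨k + i - j, by push_cast; ring⟩

/-- Contribution of one coordinate when half a unit of its own sign is split off. It is negative
only for `|t| < 1 / 2`, which is how splittings restrict coordinates. -/
theorem sign_half_mul {s : ℤ} {t : ℝ} (A : ℝ) (hs : s = 1 ∨ s = -1) (hst : (s : ℝ) * t = |t|) :
    A * (s / 2) * (t - s / 2) = A * (|t| - 1 / 2) / 2 := by
  have : (s : ℝ) * s = 1 := by rcases hs with rfl | rfl <;> norm_num
  rw [← hst]
  linear_combination -A / 4 * this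

theorem ne_zero_of_mem_intClass_half {t : ℝ} (h : t ∈ intClass (1 / 2)) : t ≠ 0 := by
  rintro rfl
  have := half_cases h (by norm_num)
  norm_num at this

/-! ### The difference sets of the two groups and their irreducible elements -/

/-- The differences between the orbit of `(X / 2, Y / 2, Z / 2)` under `P 2₁/a 2₁/b 2₁/c`
and that point. -/
def pbcaDifferences (X Y Z : ℝ) : Set (ℝ × ℝ × ℝ) :=
  intClass 0 ×ˢ intClass 0 ×ˢ intClass 0 ∪
  intClass (1 / 2) ×ˢ intClass 0 ×ˢ intClass (1 / 2 - Z) ∪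
  intClass (1 / 2 - X) ×ˢ intClass (1 / 2) ×ˢ intClass 0 ∪
  intClass 0 ×ˢ intClass (1 / 2 - Y) ×ˢ intClass (1 / 2) ∪
  intClass (-X) ×ˢ intClass (-Y) ×ˢ intClass (-Z) ∪
  intClass (1 / 2 - X) ×ˢ intClass (-Y) ×ˢ intClass (1 / 2) ∪
  intClass (1 / 2) ×ˢ intClass (1 / 2 - Y) ×ˢ intClass (-Z) ∪
  intClass (-X) ×ˢ intClass (1 / 2) ×ˢ intClass (1 / 2 - Z)

/-- The differences between the orbit of `(X / 2, Y / 2, Z / 2)` under `P 2₁/n 2/c 2₁/a`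
and that point. -/
def pbcnDifferences (X Y Z : ℝ) : Set (ℝ × ℝ × ℝ) :=
  intClass 0 ×ˢ intClass 0 ×ˢ intClass 0 ∪
  intClass (1 / 2) ×ˢ intClass (1 / 2) ×ˢ intClass (1 / 2 - Z) ∪
  intClass (-X) ×ˢ intClass 0 ×ˢ intClass (1 / 2) ∪
  intClass (1 / 2) ×ˢ intClass (1 / 2 - Y) ×ˢ intClass 0 ∪
  intClass (-X) ×ˢ intClass (-Y) ×ˢ intClass (-Z) ∪
  intClass (1 / 2 - X) ×ˢ intClass (1 / 2 - Y) ×ˢ intClass (1 / 2) ∪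
  intClass (1 / 2 - X) ×ˢ intClass (1 / 2) ×ˢ intClass (-Z) ∪
  intClass 0 ×ˢ intClass (-Y) ×ˢ intClass (1 / 2 - Z)

theorem zero_mem_intClass_zero : (0 : ℝ) ∈ intClass 0 := ⟨0, by norm_num⟩

theorem add_intCast_mem_prod {α β γ x y z : ℝ}
    (h : (x, y, z) ∈ intClass α ×ˢ intClass β ×ˢ intClass γ) (i j k : ℤ) :
    (x, y, z) + ((i : ℝ), (j : ℝ), (k : ℝ)) ∈ intClass α ×ˢ intClass β ×ˢ intClass γ :=
  ⟨add_intCast_mem_intClass h.1 i, add_intCast_mem_intClass h.2.1 j,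
    add_intCast_mem_intClass h.2.2 k⟩

theorem latticeInvariant_pbca (X Y Z : ℝ) : LatticeInvariant (pbcaDifferences X Y Z) := by
  refine ⟨?_, ?_⟩
  · iterate 7 left
    exact ⟨zero_mem_intClass_zero, zero_mem_intClass_zero, zero_mem_intClass_zero⟩
  · rintro ⟨x, y, z⟩ hv i j k
    rcases hv with ((((((h | h) | h) | h) | h) | h) | h) | h <;>
      replace h := add_intCast_mem_prod h i j k <;> unfold pbcaDifferences <;>
      simp only [Set.mem_union, h, true_or, or_true]

theorem latticeInvariant_pbcn (X Y Z : ℝ) : LatticeInvariant (pbcnDifferences X Y Z) := by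
  refine ⟨?_, ?_⟩
  · iterate 7 left
    exact ⟨zero_mem_intClass_zero, zero_mem_intClass_zero, zero_mem_intClass_zero⟩
  · rintro ⟨x, y, z⟩ hv i j k
    rcases hv with ((((((h | h) | h) | h) | h) | h) | h) | h <;>
      replace h := add_intCast_mem_prod h i j k <;> unfold pbcnDifferences <;>
      simp only [Set.mem_union, h, true_or, or_true]

/-- Each screw is a product of two glides modulo the lattice. The corresponding splitting overlaps
in a single coordinate, which must then be less than `1 / 2` in absolute value; this cuts each screw
coset from eight box vectors to four. -/
theorem encard_irreducibles_pbca {A B C : ℝ} (hA : 0 < A) (hB : 0 < B) (hC : 0 < C) (X Y Z : ℝ) :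
    (irreducibles A B C (pbcaDifferences X Y Z)).encard ≤ 38 := by
  let I : ℝ → Set ℝ := fun α => intClass α ∩ {t | |t| < 1}
  let J : ℝ → Set ℝ := fun α => intClass α ∩ {t | |t| < 1 / 2}
  have hcover : irreducibles A B C (pbcaDifferences X Y Z) ⊆
      crossVectors ∪
      I (1 / 2) ×ˢ I 0 ×ˢ I (1 / 2 - Z) ∪
      I (1 / 2 - X) ×ˢ I (1 / 2) ×ˢ I 0 ∪
      I 0 ×ˢ I (1 / 2 - Y) ×ˢ I (1 / 2) ∪
      I (-X) ×ˢ I (-Y) ×ˢ I (-Z) ∪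
      I (1 / 2 - X) ×ˢ J (-Y) ×ˢ I (1 / 2) ∪
      I (1 / 2) ×ˢ I (1 / 2 - Y) ×ˢ J (-Z) ∪
      J (-X) ×ˢ I (1 / 2) ×ˢ I (1 / 2 - Z) := by
    intro v hv
    rcases irreducibles_box hA hB hC (latticeInvariant_pbca X Y Z) hv with h | hbox
    · iterate 7 left
      exact h
    obtain ⟨x, y, z⟩ := v
    obtain ⟨b1, b2, b3⟩ := hbox
    obtain ⟨hvD, hv0, hirr⟩ := hv
    simp only at b1 b2 b3
    rcases hvD with ((((((h | h) | h) | h) | h) | h) | h) | h <;> obtain ⟨h1, h2, h3⟩ := h <;>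
      simp only at h1 h2 h3
    · exfalso
      apply hv0
      rw [intClass_eq_zero h1 b1, intClass_eq_zero h2 b2, intClass_eq_zero h3 b3]
      rfl
    · iterate 6 left
      right; exact ⟨⟨h1, b1⟩, ⟨h2, b2⟩, ⟨h3, b3⟩⟩
    · iterate 5 left
      right; exact ⟨⟨h1, b1⟩, ⟨h2, b2⟩, ⟨h3, b3⟩⟩
    · iterate 4 left
      right; exact ⟨⟨h1, b1⟩, ⟨h2, b2⟩, ⟨h3, b3⟩⟩
    · iterate 3 left
      right; exact ⟨⟨h1, b1⟩, ⟨h2, b2⟩, ⟨h3, b3⟩⟩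
    · iterate 2 left
      right
      refine ⟨⟨h1, b1⟩, ⟨h2, ?_⟩, ⟨h3, b3⟩⟩
      obtain ⟨s, hs, hst⟩ := exists_sign_mul_eq_abs y
      -- Split into a `b`-glide and a `c`-glide difference, both nonzero because of a half-integral
      -- coordinate.
      have := hirr (x, s / 2, 0)
        (by iterate 5 left
            right; exact ⟨h1, half_mem_intClass hs, zero_mem_intClass_zero⟩)
        (0, y - s / 2, z)
        (by iterate 4 left
            right; exact ⟨zero_mem_intClass_zero, sub_mem_intClass h2 (half_mem_intClass hs)
              ⟨-1, by push_cast; ring⟩, h3⟩)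
        (fun h0 => ne_zero_of_mem_intClass_half (half_mem_intClass hs) (congrArg (·.2.1) h0))
        (fun h0 => ne_zero_of_mem_intClass_half h3 (congrArg (·.2.2) h0)) (by simp)
      simp only [diagInner, sign_half_mul B hs hst] at this
      show |y| < 1 / 2
      nlinarith
    · left; right
      refine ⟨⟨h1, b1⟩, ⟨h2, b2⟩, ⟨h3, ?_⟩⟩
      obtain ⟨s, hs, hst⟩ := exists_sign_mul_eq_abs z
      have := hirr (0, y, s / 2)
        (by iterate 4 left
            right; exact ⟨zero_mem_intClass_zero, h2, half_mem_intClass hs⟩)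
        (x, 0, z - s / 2)
        (by iterate 6 left
            right; exact ⟨h1, zero_mem_intClass_zero, sub_mem_intClass h3 (half_mem_intClass hs)
              ⟨-1, by push_cast; ring⟩⟩)
        (fun h0 => ne_zero_of_mem_intClass_half (half_mem_intClass hs) (congrArg (·.2.2) h0))
        (fun h0 => ne_zero_of_mem_intClass_half h1 (congrArg (·.1) h0)) (by simp)
      simp only [diagInner, sign_half_mul C hs hst] at this
      show |z| < 1 / 2
      nlinarith
    · right
      refine ⟨⟨h1, ?_⟩, ⟨h2, b2⟩, ⟨h3, b3⟩⟩
      obtain ⟨s, hs, hst⟩ := exists_sign_mul_eq_abs x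
      have := hirr (s / 2, 0, z)
        (by iterate 6 left
            right; exact ⟨half_mem_intClass hs, zero_mem_intClass_zero, h3⟩)
        (x - s / 2, y, 0)
        (by iterate 5 left
            right; exact ⟨sub_mem_intClass h1 (half_mem_intClass hs)
              ⟨-1, by push_cast; ring⟩, h2, zero_mem_intClass_zero⟩)
        (fun h0 => ne_zero_of_mem_intClass_half (half_mem_intClass hs) (congrArg (·.1) h0))
        (fun h0 => ne_zero_of_mem_intClass_half h2 (congrArg (·.2.1) h0)) (by simp)
      simp only [diagInner, sign_half_mul A hs hst] at this
      show |x| < 1 / 2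
      nlinarith
  have I0 : (I 0).encard ≤ 1 := encard_intClass_zero
  have I2 : ∀ α, (I α).encard ≤ 2 := encard_intClass
  have J1 : ∀ α, (J α).encard ≤ 1 := encard_intClass_near
  refine (Set.encard_le_encard hcover).trans ?_
  refine (encard_union_le_add (encard_union_le_add (encard_union_le_add (encard_union_le_add
    (encard_union_le_add (encard_union_le_add (encard_union_le_add encard_crossVectors
    (encard_prod_le (I2 _) (encard_prod_le I0 (I2 _))))
    (encard_prod_le (I2 _) (encard_prod_le (I2 _) I0)))
    (encard_prod_le I0 (encard_prod_le (I2 _) (I2 _))))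
    (encard_prod_le (I2 _) (encard_prod_le (I2 _) (I2 _))))
    (encard_prod_le (I2 _) (encard_prod_le (J1 _) (I2 _))))
    (encard_prod_le (I2 _) (encard_prod_le (I2 _) (J1 _))))
    (encard_prod_le (J1 _) (encard_prod_le (I2 _) (I2 _)))).trans ?_
  norm_num

/-- The `n`-glide coset may keep eight vectors, but the inversion coset is cut to two by two
different splittings. Splittings that overlap in two coordinates give a weighted condition, counted
by `encard_intClass_pair`. -/
theorem encard_irreducibles_pbcn {A B C : ℝ} (hA : 0 < A) (hB : 0 < B) (hC : 0 < C) (X Y Z : ℝ) :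
    (irreducibles A B C (pbcnDifferences X Y Z)).encard ≤ 38 := by
  let I : ℝ → Set ℝ := fun α => intClass α ∩ {t | |t| < 1}
  let J : ℝ → Set ℝ := fun α => intClass α ∩ {t | |t| < 1 / 2}
  let K : ℝ → ℝ → ℝ → ℝ → Set (ℝ × ℝ) := fun α β A B =>
    {p : ℝ × ℝ | p.1 ∈ intClass α ∧ p.2 ∈ intClass β ∧ |p.1| < 1 ∧ |p.2| < 1 ∧
      A * (|p.1| - 1 / 2) + B * (|p.2| - 1 / 2) < 0}
  have hcover : irreducibles A B C (pbcnDifferences X Y Z) ⊆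
      crossVectors ∪
      I (1 / 2) ×ˢ I (1 / 2) ×ˢ I (1 / 2 - Z) ∪
      I (-X) ×ˢ I 0 ×ˢ I (1 / 2) ∪
      I (1 / 2) ×ˢ I (1 / 2 - Y) ×ˢ I 0 ∪
      (fun q : (ℝ × ℝ) × ℝ => (q.1.1, q.1.2, q.2)) '' (K (-X) (-Y) A B ×ˢ J (-Z)) ∪
      J (1 / 2 - X) ×ˢ I (1 / 2 - Y) ×ˢ I (1 / 2) ∪
      (fun q : (ℝ × ℝ) × ℝ => (q.1.1, q.2, q.1.2)) '' (K (1 / 2 - X) (-Z) A C ×ˢ I (1 / 2)) ∪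
      I 0 ×ˢ I (-Y) ×ˢ I (1 / 2 - Z) := by
    intro v hv
    rcases irreducibles_box hA hB hC (latticeInvariant_pbcn X Y Z) hv with h | hbox
    · iterate 7 left
      exact h
    obtain ⟨x, y, z⟩ := v
    obtain ⟨b1, b2, b3⟩ := hbox
    obtain ⟨hvD, hv0, hirr⟩ := hv
    simp only at b1 b2 b3
    rcases hvD with ((((((h | h) | h) | h) | h) | h) | h) | h <;> obtain ⟨h1, h2, h3⟩ := h <;>
      simp only at h1 h2 h3
    · exfalso
      apply hv0
      rw [intClass_eq_zero h1 b1, intClass_eq_zero h2 b2, intClass_eq_zero h3 b3]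
      rfl
    · iterate 6 left
      right; exact ⟨⟨h1, b1⟩, ⟨h2, b2⟩, ⟨h3, b3⟩⟩
    · iterate 5 left
      right; exact ⟨⟨h1, b1⟩, ⟨h2, b2⟩, ⟨h3, b3⟩⟩
    · iterate 4 left
      right; exact ⟨⟨h1, b1⟩, ⟨h2, b2⟩, ⟨h3, b3⟩⟩
    · obtain ⟨r, hr, hrt⟩ := exists_sign_mul_eq_abs x
      obtain ⟨s, hs, hst⟩ := exists_sign_mul_eq_abs y
      obtain ⟨t, ht, htt⟩ := exists_sign_mul_eq_abs z
      -- In this case the rotation part of the second splitting below is zero, so that splitting is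
      -- unavailable; but then the vector already lies in the `c`-glide set of the cover.
      by_cases hu : y = 0 ∧ z = t / 2
      · obtain ⟨rfl, rfl⟩ := hu
        iterate 5 left
        right
        exact ⟨⟨h1, b1⟩, ⟨zero_mem_intClass_zero, b2⟩, ⟨half_mem_intClass ht, b3⟩⟩
      iterate 3 left
      right
      refine ⟨((x, y), z), ⟨⟨h1, h2, b1, b2, ?_⟩, h3, ?_⟩, rfl⟩
      -- Inversion as `a`-glide plus screw along `y`.
      · have := hirr (r / 2, y - s / 2, 0)
          (by iterate 4 left
              right; exact ⟨half_mem_intClass hr, sub_mem_intClass h2 (half_mem_intClass hs)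
                ⟨-1, by push_cast; ring⟩, zero_mem_intClass_zero⟩)
          (x - r / 2, s / 2, z)
          (by left; right
              exact ⟨sub_mem_intClass h1 (half_mem_intClass hr) ⟨-1, by push_cast; ring⟩,
                half_mem_intClass hs, h3⟩)
          (fun h0 => ne_zero_of_mem_intClass_half (half_mem_intClass hr) (congrArg (·.1) h0))
          (fun h0 => ne_zero_of_mem_intClass_half (half_mem_intClass hs) (congrArg (·.2.1) h0))
          (by simp)
        have e := sign_half_mul B hs hst
        simp only [diagInner, sign_half_mul A hr hrt] at this
        show A * (|x| - 1 / 2) + B * (|y| - 1 / 2) < 0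
        linarith
      -- Inversion as `c`-glide plus rotation about `x`.
      · have := hirr (x, 0, t / 2)
          (by iterate 5 left
              right; exact ⟨h1, zero_mem_intClass_zero, half_mem_intClass ht⟩)
          (0, y, z - t / 2)
          (by right; exact ⟨zero_mem_intClass_zero, h2,
                sub_mem_intClass h3 (half_mem_intClass ht) ⟨-1, by push_cast; ring⟩⟩)
          (fun h0 => ne_zero_of_mem_intClass_half (half_mem_intClass ht) (congrArg (·.2.2) h0))
          (fun h0 => hu ⟨congrArg (·.2.1) h0, sub_eq_zero.1 (congrArg (·.2.2) h0)⟩)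
          (by simp)
        simp only [diagInner, sign_half_mul C ht htt] at this
        show |z| < 1 / 2
        nlinarith
    · iterate 2 left
      right
      refine ⟨⟨h1, ?_⟩, ⟨h2, b2⟩, ⟨h3, b3⟩⟩
      obtain ⟨s, hs, hst⟩ := exists_sign_mul_eq_abs x
      have := hirr (s / 2, y, 0)
        (by iterate 4 left
            right; exact ⟨half_mem_intClass hs, h2, zero_mem_intClass_zero⟩)
        (x - s / 2, 0, z)
        (by iterate 5 left
            right; exact ⟨sub_mem_intClass h1 (half_mem_intClass hs)
              ⟨0, by push_cast; ring⟩, zero_mem_intClass_zero, h3⟩)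
        (fun h0 => ne_zero_of_mem_intClass_half (half_mem_intClass hs) (congrArg (·.1) h0))
        (fun h0 => ne_zero_of_mem_intClass_half h3 (congrArg (·.2.2) h0)) (by simp)
      simp only [diagInner, sign_half_mul A hs hst] at this
      show |x| < 1 / 2
      nlinarith
    · left; right
      refine ⟨((x, z), y), ⟨⟨h1, h3, b1, b3, ?_⟩, h2, b2⟩, rfl⟩
      obtain ⟨s, hs, hst⟩ := exists_sign_mul_eq_abs x
      obtain ⟨t, ht, htt⟩ := exists_sign_mul_eq_abs z
      -- Screw along `y` as `n`-glide plus `c`-glide, overlapping in `x` and `z`.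
      have := hirr (s / 2, y, z - t / 2)
        (by iterate 6 left
            right; exact ⟨half_mem_intClass hs, h2, sub_mem_intClass h3 (half_mem_intClass ht)
              ⟨-1, by push_cast; ring⟩⟩)
        (x - s / 2, 0, t / 2)
        (by iterate 5 left
            right; exact ⟨sub_mem_intClass h1 (half_mem_intClass hs)
              ⟨0, by push_cast; ring⟩, zero_mem_intClass_zero, half_mem_intClass ht⟩)
        (fun h0 => ne_zero_of_mem_intClass_half (half_mem_intClass hs) (congrArg (·.1) h0))
        (fun h0 => ne_zero_of_mem_intClass_half (half_mem_intClass ht) (congrArg (·.2.2) h0))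
        (by simp)
      have e := sign_half_mul C ht htt
      simp only [diagInner, sign_half_mul A hs hst] at this
      show A * (|x| - 1 / 2) + C * (|z| - 1 / 2) < 0
      linarith
    · right; exact ⟨⟨h1, b1⟩, ⟨h2, b2⟩, ⟨h3, b3⟩⟩
  have I0 : (I 0).encard ≤ 1 := encard_intClass_zero
  have I2 : ∀ α, (I α).encard ≤ 2 := encard_intClass
  have J1 : ∀ α, (J α).encard ≤ 1 := encard_intClass_near
  have K2 : ∀ α β A B, (K α β A B).encard ≤ 2 := encard_intClass_pair
  refine (Set.encard_le_encard hcover).trans ?_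
  refine (encard_union_le_add (encard_union_le_add (encard_union_le_add (encard_union_le_add
    (encard_union_le_add (encard_union_le_add (encard_union_le_add encard_crossVectors
    (encard_prod_le (I2 _) (encard_prod_le (I2 _) (I2 _))))
    (encard_prod_le (I2 _) (encard_prod_le I0 (I2 _))))
    (encard_prod_le (I2 _) (encard_prod_le (I2 _) I0)))
    ((Set.encard_image_le _ _).trans (encard_prod_le (K2 _ _ _ _) (J1 _))))
    (encard_prod_le (J1 _) (encard_prod_le (I2 _) (I2 _))))
    ((Set.encard_image_le _ _).trans (encard_prod_le (K2 _ _ _ _) (I2 _))))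
    (encard_prod_le I0 (encard_prod_le (I2 _) (I2 _)))).trans ?_
  norm_num

/-! ### From coordinate differences to facets -/

/-- The vector with the given coordinates. -/
def toVec (v : ℝ × ℝ × ℝ) : Fin 3 → ℝ := ![v.1, v.2.1, v.2.2]

theorem toVec_add (v w : ℝ × ℝ × ℝ) : toVec (v + w) = toVec v + toVec w := by
  ext i; fin_cases i <;> simp [toVec]

theorem toVec_eq_zero {v : ℝ × ℝ × ℝ} : toVec v = 0 ↔ v = 0 := by
  obtain ⟨x, y, z⟩ := v
  simp [toVec]

theorem encard_facets_le_irreducibles {A B C : ℝ} {ψ : (Fin 3 → ℝ) ≃ₗ[ℝ] E3}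
    (hin : ∀ v w, inner ℝ (ψ (toVec v)) (ψ (toVec w)) = diagInner A B C v w)
    {S : Set E3} {P : E3} {D : Set (ℝ × ℝ × ℝ)} (hS : LocFinite S)
    (hSD : ∀ Q, Q ∈ S ↔ ∃ v ∈ D, Q = ψ (toVec v) + P) :
    (facets (voronoiRegion S P)).encard ≤ (irreducibles A B C D).encard := by
  refine le_trans (Set.encard_le_encard ?_)
    (Set.encard_image_le (fun v => contactSet S P (ψ (toVec v) + P)) _)
  intro F hF
  obtain ⟨Q, hQ, hQP, rfl⟩ := exists_eq_contactSet hS hF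
  obtain ⟨v, hv, rfl⟩ := (hSD Q).1 hQ
  have hne : ∀ w : ℝ × ℝ × ℝ, w ≠ 0 → ψ (toVec w) + P - P ≠ 0 := fun w hw => by
    rw [add_sub_cancel_right]
    exact fun h => hw (toVec_eq_zero.1 (ψ.map_eq_zero_iff.1 h))
  refine ⟨v, ⟨hv, ?_, ?_⟩, rfl⟩
  · rintro rfl
    apply hQP
    rw [toVec_eq_zero.2 rfl, map_zero, zero_add]
  · intro w hw u hu hw0 hu0 hsum
    by_contra hcon
    refine finrank_contactSet_ne_two ((hSD _).2 ⟨w, hw, rfl⟩) ((hSD _).2 ⟨u, hu, rfl⟩)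
      (hne w hw0) (hne u hu0) ?_ ?_ hF.2
    · rw [← hsum, toVec_add, map_add]
      abel
    · rw [add_sub_cancel_right, add_sub_cancel_right, hin]
      exact not_lt.1 hcon

theorem finite_intClass_inter (α M : ℝ) : (intClass α ∩ {t | |t| ≤ M}).Finite := by
  refine ((Set.finite_Icc ⌊-M - α⌋ ⌈M - α⌉).image (fun k : ℤ => α + (k : ℝ))).subset ?_
  rintro _ ⟨⟨k, rfl⟩, h⟩
  have h := abs_le.1 (show |α + k| ≤ M from h)
  refine ⟨k, ⟨?_, ?_⟩, rfl⟩
  · have := Int.floor_le (-M - α)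
    have : ((⌊-M - α⌋ : ℤ) : ℝ) ≤ k := by linarith
    exact_mod_cast this
  · have := Int.le_ceil (M - α)
    have : (k : ℝ) ≤ ((⌈M - α⌉ : ℤ) : ℝ) := by linarith
    exact_mod_cast this

/-- The cube of vectors with coordinates of absolute value at most `M`. -/
def cube (M : ℝ) : Set (ℝ × ℝ × ℝ) := {v | |v.1| ≤ M ∧ |v.2.1| ≤ M ∧ |v.2.2| ≤ M}

theorem finite_prod_inter_cube (α β γ M : ℝ) :
    (intClass α ×ˢ intClass β ×ˢ intClass γ ∩ cube M).Finite := by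
  refine ((finite_intClass_inter α M).prod
    ((finite_intClass_inter β M).prod (finite_intClass_inter γ M))).subset ?_
  rintro ⟨x, y, z⟩ ⟨⟨h1, h2, h3⟩, h4, h5, h6⟩
  exact ⟨⟨h1, h4⟩, ⟨h2, h5⟩, ⟨h3, h6⟩⟩

theorem finite_pbca_inter_cube (X Y Z M : ℝ) : (pbcaDifferences X Y Z ∩ cube M).Finite := by
  simp only [pbcaDifferences, Set.union_inter_distrib_right, Set.finite_union,
    finite_prod_inter_cube, and_self]

theorem finite_pbcn_inter_cube (X Y Z M : ℝ) : (pbcnDifferences X Y Z ∩ cube M).Finite := by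
  simp only [pbcnDifferences, Set.union_inter_distrib_right, Set.finite_union,
    finite_prod_inter_cube, and_self]

theorem locFinite_of_differences {A B C : ℝ} (hA : 0 < A) (hB : 0 < B) (hC : 0 < C)
    {ψ : (Fin 3 → ℝ) ≃ₗ[ℝ] E3}
    (hin : ∀ v w, inner ℝ (ψ (toVec v)) (ψ (toVec w)) = diagInner A B C v w)
    {S : Set E3} {P : E3} {D : Set (ℝ × ℝ × ℝ)} (hD : ∀ M, (D ∩ cube M).Finite)
    (hSD : ∀ Q, Q ∈ S ↔ ∃ v ∈ D, Q = ψ (toVec v) + P) : LocFinite S := by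
  intro x r
  set R := (r + dist x P) ^ 2 with hR
  set M := R / A + R / B + R / C + 1 with hM
  refine ((hD M).image (fun v => ψ (toVec v) + P)).subset ?_
  rintro Q ⟨hQ, hQr⟩
  obtain ⟨v, hv, rfl⟩ := (hSD Q).1 hQ
  refine ⟨v, ⟨hv, ?_⟩, rfl⟩
  have h1 : ‖ψ (toVec v)‖ ≤ r + dist x P := by
    have := dist_triangle (ψ (toVec v) + P) x P
    rw [Metric.mem_closedBall] at hQr
    rw [dist_eq_norm (ψ (toVec v) + P) P, add_sub_cancel_right] at this
    linarith
  have h2 : diagInner A B C v v ≤ R := by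
    rw [← hin, real_inner_self_eq_norm_sq]
    exact pow_le_pow_left₀ (norm_nonneg _) h1 2
  have hA2 : 0 ≤ A * v.1 ^ 2 := by positivity
  have hB2 : 0 ≤ B * v.2.1 ^ 2 := by positivity
  have hC2 : 0 ≤ C * v.2.2 ^ 2 := by positivity
  have hR0 : 0 ≤ R := by positivity
  have hRA : 0 ≤ R / A := by positivity
  have hRB : 0 ≤ R / B := by positivity
  have hRC : 0 ≤ R / C := by positivity
  rw [diagInner] at h2
  -- Uses `2|t| ≤ t² + 1` instead of a square root.
  have key : ∀ a t : ℝ, 0 < a → a * t ^ 2 ≤ R → |t| ≤ R / a + 1 := by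
    intro a t ha h
    have : t ^ 2 ≤ R / a := by rw [le_div_iff₀ ha]; linarith
    rw [← sq_abs] at this
    nlinarith [sq_nonneg (|t| - 1), abs_nonneg t]
  refine ⟨?_, ?_, ?_⟩
  · have := key A v.1 hA (by linarith); linarith
  · have := key B v.2.1 hB (by linarith); linarith
  · have := key C v.2.2 hC (by linarith); linarith

/-! ### Transport to coordinates and the shape of the metric -/

theorem coordOp_apply (ε : Fin 3 → ℝˣ) (t x : Fin 3 → ℝ) :
    coordOp ε t x = fun i => (ε i : ℝ) * x i + t i := rfl

theorem coordOp_inv_apply (ε : Fin 3 → ℝˣ) (t x : Fin 3 → ℝ) :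
    (coordOp ε t)⁻¹ x = fun i => ((ε i)⁻¹ : ℝˣ) * (x i - t i) := rfl

theorem exists_isometry_of_isOfType {G : Subgroup (E3 ≃ᵃⁱ[ℝ] E3)}
    {H : Subgroup ((Fin 3 → ℝ) ≃ᵃ[ℝ] (Fin 3 → ℝ))} {φ : (Fin 3 → ℝ) ≃ᵃ[ℝ] E3}
    (hφ : {f : E3 ≃ᵃ[ℝ] E3 | ∃ g ∈ G, g.toAffineEquiv = f} =
      {f : E3 ≃ᵃ[ℝ] E3 | ∃ h ∈ H, (φ.symm.trans h).trans φ = f})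
    {h : (Fin 3 → ℝ) ≃ᵃ[ℝ] (Fin 3 → ℝ)} (hh : h ∈ H) :
    ∃ g ∈ G, ∀ p, g (φ p) = φ (h p) := by
  have : (φ.symm.trans h).trans φ ∈ {f : E3 ≃ᵃ[ℝ] E3 | ∃ g ∈ G, g.toAffineEquiv = f} := by
    rw [hφ]
    exact ⟨h, hh, rfl⟩
  obtain ⟨g, hg, he⟩ := this
  refine ⟨g, hg, fun p => ?_⟩
  have := congrArg (fun f : E3 ≃ᵃ[ℝ] E3 => f (φ p)) he
  simpa using this

theorem exists_affine_of_isOfType {G : Subgroup (E3 ≃ᵃⁱ[ℝ] E3)}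
    {H : Subgroup ((Fin 3 → ℝ) ≃ᵃ[ℝ] (Fin 3 → ℝ))} {φ : (Fin 3 → ℝ) ≃ᵃ[ℝ] E3}
    (hφ : {f : E3 ≃ᵃ[ℝ] E3 | ∃ g ∈ G, g.toAffineEquiv = f} =
      {f : E3 ≃ᵃ[ℝ] E3 | ∃ h ∈ H, (φ.symm.trans h).trans φ = f})
    {g : E3 ≃ᵃⁱ[ℝ] E3} (hg : g ∈ G) :
    ∃ h ∈ H, ∀ p, g (φ p) = φ (h p) := by
  have : g.toAffineEquiv ∈ {f : E3 ≃ᵃ[ℝ] E3 | ∃ h ∈ H, (φ.symm.trans h).trans φ = f} := by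
    rw [← hφ]
    exact ⟨g, hg, rfl⟩
  obtain ⟨h, hh, he⟩ := this
  refine ⟨h, hh, fun p => ?_⟩
  have := congrArg (fun f : E3 ≃ᵃ[ℝ] E3 => f (φ p)) he
  simpa using this.symm

/-- The conjugated operation is an isometry, so its linear part preserves norms, and hence inner
products by polarization. -/
theorem inner_linear_eq {G : Subgroup (E3 ≃ᵃⁱ[ℝ] E3)}
    {H : Subgroup ((Fin 3 → ℝ) ≃ᵃ[ℝ] (Fin 3 → ℝ))} {φ : (Fin 3 → ℝ) ≃ᵃ[ℝ] E3}
    (hφ : {f : E3 ≃ᵃ[ℝ] E3 | ∃ g ∈ G, g.toAffineEquiv = f} =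
      {f : E3 ≃ᵃ[ℝ] E3 | ∃ h ∈ H, (φ.symm.trans h).trans φ = f})
    {ε : Fin 3 → ℝˣ} {t : Fin 3 → ℝ} (hh : coordOp ε t ∈ H) (v w : Fin 3 → ℝ) :
    inner ℝ (φ.linear fun i => ε i * v i) (φ.linear fun i => ε i * w i) =
      inner ℝ (φ.linear v) (φ.linear w) := by
  obtain ⟨g, -, hg⟩ := exists_isometry_of_isOfType hφ hh
  have hnorm : ∀ v : Fin 3 → ℝ, ‖φ.linear fun i => (ε i : ℝ) * v i‖ = ‖φ.linear v‖ := by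
    intro v
    have h1 := g.dist_map (φ v) (φ 0)
    have hsub : ∀ a b, φ a - φ b = φ.linear (a - b) := fun a b =>
      (φ.toAffineMap.linearMap_vsub a b).symm
    rw [hg, hg, dist_eq_norm, dist_eq_norm, hsub, hsub] at h1
    have h2 : coordOp ε t v - coordOp ε t 0 = fun i => (ε i : ℝ) * v i := by
      funext i
      simp [coordOp_apply]
    rw [h2] at h1
    simpa using h1
  have hadd : (φ.linear fun i => (ε i : ℝ) * v i) + (φ.linear fun i => (ε i : ℝ) * w i) =
      φ.linear fun i => (ε i : ℝ) * (v + w) i := by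
    rw [← map_add]
    congr 1
    funext i
    simp [mul_add]
  rw [real_inner_eq_norm_add_mul_self_sub_norm_mul_self_sub_norm_mul_self_div_two, hadd,
    hnorm, hnorm, hnorm, map_add,
    ← real_inner_eq_norm_add_mul_self_sub_norm_mul_self_sub_norm_mul_self_div_two]

/-- A group whose point group contains the reflections in the three coordinate planes is
isometric only for diagonal metrics. -/
theorem exists_diagInner {G : Subgroup (E3 ≃ᵃⁱ[ℝ] E3)}
    {H : Subgroup ((Fin 3 → ℝ) ≃ᵃ[ℝ] (Fin 3 → ℝ))} {φ : (Fin 3 → ℝ) ≃ᵃ[ℝ] E3}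
    (hφ : {f : E3 ≃ᵃ[ℝ] E3 | ∃ g ∈ G, g.toAffineEquiv = f} =
      {f : E3 ≃ᵃ[ℝ] E3 | ∃ h ∈ H, (φ.symm.trans h).trans φ = f})
    {t₁ t₂ : Fin 3 → ℝ} (h₁ : coordOp ![-1, 1, 1] t₁ ∈ H) (h₂ : coordOp ![1, -1, 1] t₂ ∈ H) :
    ∃ A B C : ℝ, 0 < A ∧ 0 < B ∧ 0 < C ∧ ∀ v w,
      inner ℝ (φ.linear (toVec v)) (φ.linear (toVec w)) = diagInner A B C v w := by
  set e₀ := φ.linear ![1, 0, 0] with he₀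
  set e₁ := φ.linear ![0, 1, 0] with he₁
  set e₂ := φ.linear ![0, 0, 1] with he₂
  have hpos : ∀ v : Fin 3 → ℝ, v ≠ 0 → 0 < inner ℝ (φ.linear v) (φ.linear v) := fun v hv =>
    real_inner_self_pos.2 fun h => hv (φ.linear.map_eq_zero_iff.1 h)
  have hdec : ∀ v, φ.linear (toVec v) = v.1 • e₀ + v.2.1 • e₁ + v.2.2 • e₂ := by
    intro v
    rw [he₀, he₁, he₂, ← map_smul, ← map_smul, ← map_smul, ← map_add, ← map_add]
    congr 1
    ext i; fin_cases i <;> simp [toVec]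
  -- A reflection that negates one axis vector and fixes another makes their product equal to its
  -- negative. Two reflections reach all three pairs.
  have h01 : inner ℝ e₀ e₁ = 0 := by
    have := inner_linear_eq hφ h₁ ![1, 0, 0] ![0, 1, 0]
    rw [show (fun i => ((![-1, 1, 1] : Fin 3 → ℝˣ) i : ℝ) * (![1, 0, 0] : Fin 3 → ℝ) i) =
        -![1, 0, 0] by ext i; fin_cases i <;> simp,
      show (fun i => ((![-1, 1, 1] : Fin 3 → ℝˣ) i : ℝ) * (![0, 1, 0] : Fin 3 → ℝ) i) =
        ![0, 1, 0] by ext i; fin_cases i <;> simp, map_neg, inner_neg_left] at this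
    linarith
  have h02 : inner ℝ e₀ e₂ = 0 := by
    have := inner_linear_eq hφ h₁ ![1, 0, 0] ![0, 0, 1]
    rw [show (fun i => ((![-1, 1, 1] : Fin 3 → ℝˣ) i : ℝ) * (![1, 0, 0] : Fin 3 → ℝ) i) =
        -![1, 0, 0] by ext i; fin_cases i <;> simp,
      show (fun i => ((![-1, 1, 1] : Fin 3 → ℝˣ) i : ℝ) * (![0, 0, 1] : Fin 3 → ℝ) i) =
        ![0, 0, 1] by ext i; fin_cases i <;> simp, map_neg, inner_neg_left] at this
    linarith
  have h12 : inner ℝ e₁ e₂ = 0 := by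
    have := inner_linear_eq hφ h₂ ![0, 1, 0] ![0, 0, 1]
    rw [show (fun i => ((![1, -1, 1] : Fin 3 → ℝˣ) i : ℝ) * (![0, 1, 0] : Fin 3 → ℝ) i) =
        -![0, 1, 0] by ext i; fin_cases i <;> simp,
      show (fun i => ((![1, -1, 1] : Fin 3 → ℝˣ) i : ℝ) * (![0, 0, 1] : Fin 3 → ℝ) i) =
        ![0, 0, 1] by ext i; fin_cases i <;> simp, map_neg, inner_neg_left] at this
    linarith
  refine ⟨inner ℝ e₀ e₀, inner ℝ e₁ e₁, inner ℝ e₂ e₂, hpos _ (by simp), hpos _ (by simp),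
    hpos _ (by simp), fun v w => ?_⟩
  have h10 : inner ℝ e₁ e₀ = 0 := by rw [real_inner_comm, h01]
  have h20 : inner ℝ e₂ e₀ = 0 := by rw [real_inner_comm, h02]
  have h21 : inner ℝ e₂ e₁ = 0 := by rw [real_inner_comm, h12]
  rw [hdec, hdec, diagInner]
  simp only [inner_add_left, inner_add_right, real_inner_smul_left, real_inner_smul_right,
    h01, h02, h12, h10, h20, h21]
  ring

theorem encard_facets_le_of_isOfType {G : Subgroup (E3 ≃ᵃⁱ[ℝ] E3)}
    {H : Subgroup ((Fin 3 → ℝ) ≃ᵃ[ℝ] (Fin 3 → ℝ))} (hG : IsOfType G H) (P : E3)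
    {t₁ t₂ : Fin 3 → ℝ} (h₁ : coordOp ![-1, 1, 1] t₁ ∈ H) (h₂ : coordOp ![1, -1, 1] t₂ ∈ H)
    {D : (Fin 3 → ℝ) → Set (ℝ × ℝ × ℝ)} (hD : ∀ p M, (D p ∩ cube M).Finite)
    (horb : ∀ p q, (∃ h ∈ H, h p = q) ↔ ∃ v ∈ D p, q = toVec v + p) {n : ℕ∞}
    (hn : ∀ p, ∀ A B C : ℝ, 0 < A → 0 < B → 0 < C → (irreducibles A B C (D p)).encard ≤ n) :
    (facets (dirichletStereohedron G P)).encard ≤ n := by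
  obtain ⟨φ, hφ⟩ := hG
  obtain ⟨A, B, C, hA, hB, hC, hin⟩ := exists_diagInner hφ h₁ h₂
  have hSD : ∀ Q, Q ∈ isometryOrbit G P ↔
      ∃ v ∈ D (φ.symm P), Q = φ.linear (toVec v) + P := by
    intro Q
    have hvec : ∀ v, φ.linear (toVec v) + P = φ (toVec v + φ.symm P) := by
      intro v
      have := φ.map_vadd (φ.symm P) (toVec v)
      rw [φ.apply_symm_apply] at this
      exact this.symm
    constructor
    · rintro ⟨g, hg, rfl⟩
      obtain ⟨h, hh, he⟩ := exists_affine_of_isOfType hφ hg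
      obtain ⟨v, hv, hq⟩ := (horb (φ.symm P) _).1 ⟨h, hh, rfl⟩
      refine ⟨v, hv, ?_⟩
      rw [hvec, ← hq, ← he, φ.apply_symm_apply]
    · rintro ⟨v, hv, rfl⟩
      obtain ⟨h, hh, hq⟩ := (horb (φ.symm P) _).2 ⟨v, hv, rfl⟩
      obtain ⟨g, hg, he⟩ := exists_isometry_of_isOfType hφ hh
      refine ⟨g, hg, ?_⟩
      rw [hvec, ← hq, ← he, φ.apply_symm_apply]
  exact (encard_facets_le_irreducibles hin
    (locFinite_of_differences hA hB hC hin (hD _) hSD) hSD).trans (hn _ A B C hA hB hC)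

/-! ### Orbits of the two groups -/

theorem coordOp_one_eq (t : Fin 3 → ℝ) :
    coordOp ![1, 1, 1] t = AffineEquiv.constVAddHom ℝ (Fin 3 → ℝ) (Multiplicative.ofAdd t) := by
  ext x i
  change _ = t i + x i
  fin_cases i <;> simp [coordOp_apply, add_comm]

theorem coordOp_int_mem {H : Subgroup ((Fin 3 → ℝ) ≃ᵃ[ℝ] (Fin 3 → ℝ))}
    (hH : unitTranslations ⊆ H) (i j k : ℤ) : coordOp ![1, 1, 1] ![i, j, k] ∈ H := by
  have h0 : coordOp ![1, 1, 1] ![1, 0, 0] ∈ H := hH (by simp [unitTranslations])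
  have h1 : coordOp ![1, 1, 1] ![0, 1, 0] ∈ H := hH (by simp [unitTranslations])
  have h2 : coordOp ![1, 1, 1] ![0, 0, 1] ∈ H := hH (by simp [unitTranslations])
  have := H.mul_mem (H.mul_mem (H.zpow_mem h0 i) (H.zpow_mem h1 j)) (H.zpow_mem h2 k)
  rw [coordOp_one_eq, coordOp_one_eq, coordOp_one_eq, ← map_zpow (AffineEquiv.constVAddHom ℝ (Fin 3 → ℝ)),
    ← map_zpow (AffineEquiv.constVAddHom ℝ (Fin 3 → ℝ)), ← map_zpow (AffineEquiv.constVAddHom ℝ (Fin 3 → ℝ)),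
    ← map_mul (AffineEquiv.constVAddHom ℝ (Fin 3 → ℝ)), ← map_mul (AffineEquiv.constVAddHom ℝ (Fin 3 → ℝ)), ← ofAdd_zsmul, ← ofAdd_zsmul, ← ofAdd_zsmul, ← ofAdd_add,
    ← ofAdd_add, ← coordOp_one_eq] at this
  convert this using 2
  ext m
  fin_cases m <;> simp

/-- Carrying `h` and `h⁻¹` together makes the inversion step of the closure induction immediate. -/
theorem closure_orbit_subset {K : Set ((Fin 3 → ℝ) ≃ᵃ[ℝ] (Fin 3 → ℝ))} {O : Set (Fin 3 → ℝ)}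
    (hK : ∀ h ∈ K, ∀ q ∈ O, h q ∈ O ∧ h⁻¹ q ∈ O) {h : (Fin 3 → ℝ) ≃ᵃ[ℝ] (Fin 3 → ℝ)}
    (hh : h ∈ Subgroup.closure K) : ∀ q ∈ O, h q ∈ O ∧ h⁻¹ q ∈ O := by
  induction hh using Subgroup.closure_induction with
  | mem x hx => exact hK x hx
  | one => exact fun q hq => ⟨hq, hq⟩
  | mul x y _ _ ihx ihy =>
    refine fun q hq => ⟨(ihx _ (ihy q hq).1).1, ?_⟩
    rw [mul_inv_rev]
    exact (ihy _ (ihx q hq).2).2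
  | inv x _ ih =>
    refine fun q hq => ⟨(ih q hq).2, ?_⟩
    rw [inv_inv]
    exact (ih q hq).1

/-- The orbit of `p` under `P 2₁/a 2₁/b 2₁/c`. -/
def pbcaOrbit (p : Fin 3 → ℝ) : Set (Fin 3 → ℝ) :=
  {q | ∃ a b c i j k : ℤ, q = ![(-1) ^ b * p 0 + (a + b) / 2 + i,
    (-1) ^ c * p 1 + (b + c) / 2 + j, (-1) ^ a * p 2 + (a + c) / 2 + k]}

/-- The orbit of `p` under `P 2₁/n 2/c 2₁/a`. -/
def pbcnOrbit (p : Fin 3 → ℝ) : Set (Fin 3 → ℝ) :=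
  {q | ∃ a b c i j k : ℤ, q = ![(-1) ^ b * p 0 + (a + c) / 2 + i,
    (-1) ^ c * p 1 + (a + c) / 2 + j, (-1) ^ a * p 2 + (a + b) / 2 + k]}

theorem zpow_neg_one_add_one (a : ℤ) : (-1 : ℝ) ^ (a + 1) = -(-1) ^ a := by
  rw [zpow_add_one₀ (by norm_num)]; ring

theorem zpow_neg_one_sub_one (a : ℤ) : (-1 : ℝ) ^ (a - 1) = -(-1) ^ a := by
  rw [zpow_sub_one₀ (by norm_num)]; norm_num

/-- With arbitrary integer exponents, a glide or its inverse shifts just one of `a`, `b`, `c` by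
one. Only the translation integer of the negated coordinate needs correction. -/
theorem pbca_generators_orbit (p : Fin 3 → ℝ) : ∀ h ∈ (unitTranslations ∪
    {coordOp ![1, 1, -1] ![1 / 2, 0, 1 / 2],
     coordOp ![-1, 1, 1] ![1 / 2, 1 / 2, 0],
     coordOp ![1, -1, 1] ![0, 1 / 2, 1 / 2]}), ∀ q ∈ pbcaOrbit p,
    h q ∈ pbcaOrbit p ∧ h⁻¹ q ∈ pbcaOrbit p := by
  rintro h ((rfl | rfl | rfl) | (rfl | rfl | rfl)) _ ⟨a, b, c, i, j, k, rfl⟩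
  on_goal 1 => refine ⟨⟨a, b, c, i + 1, j, k, ?_⟩, ⟨a, b, c, i - 1, j, k, ?_⟩⟩
  on_goal 3 => refine ⟨⟨a, b, c, i, j + 1, k, ?_⟩, ⟨a, b, c, i, j - 1, k, ?_⟩⟩
  on_goal 5 => refine ⟨⟨a, b, c, i, j, k + 1, ?_⟩, ⟨a, b, c, i, j, k - 1, ?_⟩⟩
  on_goal 7 => refine ⟨⟨a + 1, b, c, i, j, -a - c - k, ?_⟩, ⟨a - 1, b, c, i, j, 1 - a - c - k, ?_⟩⟩
  on_goal 9 => refine ⟨⟨a, b + 1, c, -a - b - i, j, k, ?_⟩, ⟨a, b - 1, c, 1 - a - b - i, j, k, ?_⟩⟩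
  on_goal 11 => refine ⟨⟨a, b, c + 1, i, -b - c - j, k, ?_⟩, ⟨a, b, c - 1, i, 1 - b - c - j, k, ?_⟩⟩
  all_goals
    ext m
    fin_cases m <;> simp [coordOp_apply, coordOp_inv_apply, zpow_neg_one_add_one,
      zpow_neg_one_sub_one] <;> ring

theorem pbcn_generators_orbit (p : Fin 3 → ℝ) : ∀ h ∈ (unitTranslations ∪
    {coordOp ![1, 1, -1] ![1 / 2, 1 / 2, 1 / 2],
     coordOp ![-1, 1, 1] ![0, 0, 1 / 2],
     coordOp ![1, -1, 1] ![1 / 2, 1 / 2, 0]}), ∀ q ∈ pbcnOrbit p,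
    h q ∈ pbcnOrbit p ∧ h⁻¹ q ∈ pbcnOrbit p := by
  rintro h ((rfl | rfl | rfl) | (rfl | rfl | rfl)) _ ⟨a, b, c, i, j, k, rfl⟩
  on_goal 1 => refine ⟨⟨a, b, c, i + 1, j, k, ?_⟩, ⟨a, b, c, i - 1, j, k, ?_⟩⟩
  on_goal 3 => refine ⟨⟨a, b, c, i, j + 1, k, ?_⟩, ⟨a, b, c, i, j - 1, k, ?_⟩⟩
  on_goal 5 => refine ⟨⟨a, b, c, i, j, k + 1, ?_⟩, ⟨a, b, c, i, j, k - 1, ?_⟩⟩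
  on_goal 7 => refine ⟨⟨a + 1, b, c, i, j, -a - b - k, ?_⟩, ⟨a - 1, b, c, i, j, 1 - a - b - k, ?_⟩⟩
  on_goal 9 => refine ⟨⟨a, b + 1, c, -a - c - i, j, k, ?_⟩, ⟨a, b - 1, c, -a - c - i, j, k, ?_⟩⟩
  on_goal 11 => refine ⟨⟨a, b, c + 1, i, -a - c - j, k, ?_⟩, ⟨a, b, c - 1, i, 1 - a - c - j, k, ?_⟩⟩
  all_goals
    ext m
    fin_cases m <;> simp [coordOp_apply, coordOp_inv_apply, zpow_neg_one_add_one,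
      zpow_neg_one_sub_one] <;> ring

theorem exists_toVec_add {D : Set (ℝ × ℝ × ℝ)} {p q : Fin 3 → ℝ}
    (h : (q 0 - p 0, q 1 - p 1, q 2 - p 2) ∈ D) : ∃ v ∈ D, q = toVec v + p := by
  refine ⟨_, h, ?_⟩
  ext m
  fin_cases m <;> simp [toVec]

theorem zpow_neg_one_two_mul (a : ℤ) : (-1 : ℝ) ^ (2 * a) = 1 := (even_two_mul a).neg_one_zpow

theorem exists_difference_of_mem_pbcaOrbit {p q : Fin 3 → ℝ} (hq : q ∈ pbcaOrbit p) :
    ∃ v ∈ pbcaDifferences (2 * p 0) (2 * p 1) (2 * p 2), q = toVec v + p := by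
  obtain ⟨a, b, c, i, j, k, rfl⟩ := hq
  apply exists_toVec_add
  -- The parities of `a`, `b`, `c` select the coset; the remaining even parts contribute integers.
  obtain ⟨a, rfl | rfl⟩ := Int.even_or_odd' a <;> obtain ⟨b, rfl | rfl⟩ := Int.even_or_odd' b <;>
    obtain ⟨c, rfl | rfl⟩ := Int.even_or_odd' c
  on_goal 1 => iterate 7 left
  on_goal 2 => iterate 4 left
               right
  on_goal 3 => iterate 5 left
               right
  on_goal 4 => iterate 2 left
               right
  on_goal 5 => iterate 6 left
               right
  on_goal 6 => left; right
  on_goal 7 => right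
  on_goal 8 => iterate 3 left
               right
  on_goal 1 => refine ⟨⟨a + b + i, ?_⟩, ⟨b + c + j, ?_⟩, ⟨a + c + k, ?_⟩⟩
  on_goal 4 => refine ⟨⟨a + b + i, ?_⟩, ⟨b + c + j, ?_⟩, ⟨a + c + k, ?_⟩⟩
  on_goal 7 => refine ⟨⟨a + b + i, ?_⟩, ⟨b + c + j, ?_⟩, ⟨a + c + k, ?_⟩⟩
  on_goal 10 => refine ⟨⟨a + b + i, ?_⟩, ⟨b + c + 1 + j, ?_⟩, ⟨a + c + k, ?_⟩⟩
  on_goal 13 => refine ⟨⟨a + b + i, ?_⟩, ⟨b + c + j, ?_⟩, ⟨a + c + k, ?_⟩⟩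
  on_goal 16 => refine ⟨⟨a + b + i, ?_⟩, ⟨b + c + j, ?_⟩, ⟨a + c + 1 + k, ?_⟩⟩
  on_goal 19 => refine ⟨⟨a + b + 1 + i, ?_⟩, ⟨b + c + j, ?_⟩, ⟨a + c + k, ?_⟩⟩
  on_goal 22 => refine ⟨⟨a + b + 1 + i, ?_⟩, ⟨b + c + 1 + j, ?_⟩, ⟨a + c + 1 + k, ?_⟩⟩
  all_goals
    simp [zpow_neg_one_add_one, zpow_neg_one_two_mul]
    ring

theorem exists_difference_of_mem_pbcnOrbit {p q : Fin 3 → ℝ} (hq : q ∈ pbcnOrbit p) :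
    ∃ v ∈ pbcnDifferences (2 * p 0) (2 * p 1) (2 * p 2), q = toVec v + p := by
  obtain ⟨a, b, c, i, j, k, rfl⟩ := hq
  apply exists_toVec_add
  obtain ⟨a, rfl | rfl⟩ := Int.even_or_odd' a <;> obtain ⟨b, rfl | rfl⟩ := Int.even_or_odd' b <;>
    obtain ⟨c, rfl | rfl⟩ := Int.even_or_odd' c
  on_goal 1 => iterate 7 left
  on_goal 2 => iterate 4 left
               right
  on_goal 3 => iterate 5 left
               right
  on_goal 4 => iterate 2 left
               right
  on_goal 5 => iterate 6 left
               right
  on_goal 6 => right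
  on_goal 7 => left; right
  on_goal 8 => iterate 3 left
               right
  on_goal 1 => refine ⟨⟨a + c + i, ?_⟩, ⟨a + c + j, ?_⟩, ⟨a + b + k, ?_⟩⟩
  on_goal 4 => refine ⟨⟨a + c + i, ?_⟩, ⟨a + c + j, ?_⟩, ⟨a + b + k, ?_⟩⟩
  on_goal 7 => refine ⟨⟨a + c + i, ?_⟩, ⟨a + c + j, ?_⟩, ⟨a + b + k, ?_⟩⟩
  on_goal 10 => refine ⟨⟨a + c + i, ?_⟩, ⟨a + c + j, ?_⟩, ⟨a + b + k, ?_⟩⟩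
  on_goal 13 => refine ⟨⟨a + c + i, ?_⟩, ⟨a + c + j, ?_⟩, ⟨a + b + k, ?_⟩⟩
  on_goal 16 => refine ⟨⟨a + c + 1 + i, ?_⟩, ⟨a + c + 1 + j, ?_⟩, ⟨a + b + k, ?_⟩⟩
  on_goal 19 => refine ⟨⟨a + c + i, ?_⟩, ⟨a + c + j, ?_⟩, ⟨a + b + 1 + k, ?_⟩⟩
  on_goal 22 => refine ⟨⟨a + c + 1 + i, ?_⟩, ⟨a + c + 1 + j, ?_⟩, ⟨a + b + 1 + k, ?_⟩⟩
  all_goals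
    simp [zpow_neg_one_add_one, zpow_neg_one_two_mul]
    ring

theorem pbca_orbit_iff (p q : Fin 3 → ℝ) : (∃ h ∈ spaceGroupP21a21b21c, h p = q) ↔
    ∃ v ∈ pbcaDifferences (2 * p 0) (2 * p 1) (2 * p 2), q = toVec v + p := by
  constructor
  · rintro ⟨h, hh, rfl⟩
    refine exists_difference_of_mem_pbcaOrbit
      (closure_orbit_subset (pbca_generators_orbit p) hh p ⟨0, 0, 0, 0, 0, 0, ?_⟩).1
    ext m
    fin_cases m <;> simp
  · have ha : coordOp ![1, 1, -1] ![1 / 2, 0, 1 / 2] ∈ spaceGroupP21a21b21c :=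
      Subgroup.subset_closure (by simp)
    have hb : coordOp ![-1, 1, 1] ![1 / 2, 1 / 2, 0] ∈ spaceGroupP21a21b21c :=
      Subgroup.subset_closure (by simp)
    have hc : coordOp ![1, -1, 1] ![0, 1 / 2, 1 / 2] ∈ spaceGroupP21a21b21c :=
      Subgroup.subset_closure (by simp)
    have ht : ∀ i j k : ℤ, coordOp ![1, 1, 1] ![i, j, k] ∈ spaceGroupP21a21b21c :=
      coordOp_int_mem (Set.subset_union_left.trans Subgroup.subset_closure)
    rintro ⟨⟨x, y, z⟩, hv, rfl⟩
    rcases hv with ((((((h | h) | h) | h) | h) | h) | h) | h <;>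
      obtain ⟨⟨i, hi⟩, ⟨j, hj⟩, ⟨k, hk⟩⟩ := h <;> simp only at hi hj hk <;> subst hi hj hk
    · refine ⟨_, ht i j k, ?_⟩
      ext m; fin_cases m <;> simp [coordOp_apply, toVec] <;> ring
    · refine ⟨_, mul_mem (ht i j k) ha, ?_⟩
      ext m; fin_cases m <;> simp [coordOp_apply, toVec] <;> ring
    · refine ⟨_, mul_mem (ht i j k) hb, ?_⟩
      ext m; fin_cases m <;> simp [coordOp_apply, toVec] <;> ring
    · refine ⟨_, mul_mem (ht i j k) hc, ?_⟩
      ext m; fin_cases m <;> simp [coordOp_apply, toVec] <;> ring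
    -- The shifts by `1` here and below cancel the integers produced when two half translations add
    -- up.
    · refine ⟨_, mul_mem (ht (i - 1) (j - 1) k) (mul_mem ha (mul_mem hb hc)), ?_⟩
      ext m; fin_cases m <;> simp [coordOp_apply, toVec] <;> ring
    · refine ⟨_, mul_mem (ht i (j - 1) k) (mul_mem hb hc), ?_⟩
      ext m; fin_cases m <;> simp [coordOp_apply, toVec] <;> ring
    · refine ⟨_, mul_mem (ht i j k) (mul_mem ha hc), ?_⟩
      ext m; fin_cases m <;> simp [coordOp_apply, toVec] <;> ring
    · refine ⟨_, mul_mem (ht (i - 1) j k) (mul_mem ha hb), ?_⟩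
      ext m; fin_cases m <;> simp [coordOp_apply, toVec] <;> ring

theorem pbcn_orbit_iff (p q : Fin 3 → ℝ) : (∃ h ∈ spaceGroupP21n2c21a, h p = q) ↔
    ∃ v ∈ pbcnDifferences (2 * p 0) (2 * p 1) (2 * p 2), q = toVec v + p := by
  constructor
  · rintro ⟨h, hh, rfl⟩
    refine exists_difference_of_mem_pbcnOrbit
      (closure_orbit_subset (pbcn_generators_orbit p) hh p ⟨0, 0, 0, 0, 0, 0, ?_⟩).1
    ext m
    fin_cases m <;> simp
  · have ha : coordOp ![1, 1, -1] ![1 / 2, 1 / 2, 1 / 2] ∈ spaceGroupP21n2c21a :=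
      Subgroup.subset_closure (by simp)
    have hb : coordOp ![-1, 1, 1] ![0, 0, 1 / 2] ∈ spaceGroupP21n2c21a :=
      Subgroup.subset_closure (by simp)
    have hc : coordOp ![1, -1, 1] ![1 / 2, 1 / 2, 0] ∈ spaceGroupP21n2c21a :=
      Subgroup.subset_closure (by simp)
    have ht : ∀ i j k : ℤ, coordOp ![1, 1, 1] ![i, j, k] ∈ spaceGroupP21n2c21a :=
      coordOp_int_mem (Set.subset_union_left.trans Subgroup.subset_closure)
    rintro ⟨⟨x, y, z⟩, hv, rfl⟩
    rcases hv with ((((((h | h) | h) | h) | h) | h) | h) | h <;>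
      obtain ⟨⟨i, hi⟩, ⟨j, hj⟩, ⟨k, hk⟩⟩ := h <;> simp only at hi hj hk <;> subst hi hj hk
    · refine ⟨_, ht i j k, ?_⟩
      ext m; fin_cases m <;> simp [coordOp_apply, toVec] <;> ring
    · refine ⟨_, mul_mem (ht i j k) ha, ?_⟩
      ext m; fin_cases m <;> simp [coordOp_apply, toVec] <;> ring
    · refine ⟨_, mul_mem (ht i j k) hb, ?_⟩
      ext m; fin_cases m <;> simp [coordOp_apply, toVec] <;> ring
    · refine ⟨_, mul_mem (ht i j k) hc, ?_⟩
      ext m; fin_cases m <;> simp [coordOp_apply, toVec] <;> ring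
    · refine ⟨_, mul_mem (ht i (j - 1) k) (mul_mem ha (mul_mem hb hc)), ?_⟩
      ext m; fin_cases m <;> simp [coordOp_apply, toVec] <;> ring
    · refine ⟨_, mul_mem (ht (i + 1) j k) (mul_mem hb hc), ?_⟩
      ext m; fin_cases m <;> simp [coordOp_apply, toVec] <;> ring
    · refine ⟨_, mul_mem (ht i j k) (mul_mem ha hb), ?_⟩
      ext m; fin_cases m <;> simp [coordOp_apply, toVec] <;> ring
    · refine ⟨_, mul_mem (ht (i - 1) (j - 1) k) (mul_mem ha hc), ?_⟩
      ext m; fin_cases m <;> simp [coordOp_apply, toVec] <;> ring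

theorem mainTheorem10 (G : Subgroup (E3 ≃ᵃⁱ[ℝ] E3))
    (hG : IsOfType G spaceGroupP21n2c21a ∨ IsOfType G spaceGroupP21a21b21c) (P : E3) :
    (facets (dirichletStereohedron G P)).encard ≤ 38 := by
  rcases hG with hG | hG
  · exact encard_facets_le_of_isOfType hG P (t₁ := ![0, 0, 1 / 2]) (t₂ := ![1 / 2, 1 / 2, 0])
      (Subgroup.subset_closure (by simp)) (Subgroup.subset_closure (by simp))
      (fun _ _ => finite_pbcn_inter_cube _ _ _ _) pbcn_orbit_iff
      fun _ _ _ _ hA hB hC => encard_irreducibles_pbcn hA hB hC _ _ _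
  · exact encard_facets_le_of_isOfType hG P (t₁ := ![1 / 2, 1 / 2, 0]) (t₂ := ![0, 1 / 2, 1 / 2])
      (Subgroup.subset_closure (by simp)) (Subgroup.subset_closure (by simp))
      (fun _ _ => finite_pbca_inter_cube _ _ _ _) pbca_orbit_iff
      fun _ _ _ _ hA hB hC => encard_irreducibles_pbca hA hB hC _ _ _
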